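/- Let $\Gamma$ be a totally ordered abelian group with positive cone $\Gamma^+=\{x\in\Gamma: x\ge 0\}$, let $\mathcal A$ be a unital C*-algebra, and let $\alpha:\Gamma^+\to\mathrm{End}(\mathcal A)$ be an action by (not necessarily unital) $*$-endomorphisms: $\alpha_0=\mathrm{Id}$, $\alpha_x\circ\alpha_y=\alpha_{x+y}$. Assume that $(\mathcal A,\Gamma^+,\alpha)$ is finely representable, i.e. there are a Hilbert space $H$, a faithful non-degenerate representation $\pi:\mathcal A\to L(H)$ and a semigroup homomorphism $U:\Gamma^+\to L(H)$ such that $\pi(\alpha_x(a))=U_x\pi(a)U_x^*$, $U_x^*\pi(a)U_x\in\pi(\mathcal A)$ and $U_x\pi(a)=\pi(\alpha_x(a))U_x$ for all $a\in\mathcal A$, $x\in\Gamma^+$. Let $L$ be the unique complete transfer action of the system, i.e. the unique family of continuous linear positive maps $L_x:\mathcal A\to\mathcal A$ ($x\in\Gamma^+$) with $L_{x+y}=L_y\circ L_x$, $L_x(\alpha_x(a)b)=aL_x(b)$ and $\alpha_x(L_x(a))=\alpha_x(1)a\alpha_x(1)$. Let $l_1(\Gamma,\alpha,\mathcal A)$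 be the space of all families $a=(a_g)_{g\in\Gamma}$ in $\mathcal A$ with $a_x\in\mathcal A\alpha_x(1)$ and $a_{-x}\in\alpha_x(1)\mathcal A$ for $x\in\Gamma^+$ and with $\|a\|=\sum_{g}\|a_g\|<\infty$, equipped with the coordinatewise linear structure, the involution $(a^*)_g=(a_{-g})^*$, and the product determined by $$a\delta_g\cdot b\delta_h=c\,\delta_{g+h},\qquad c=\begin{cases}a\,\alpha_{g+h}(b), & g+h\ge0,\ h<0,\\ L_{-g}(ab), & g+h\ge0,\ g<0,\\ a\,\alpha_g(b), & g,h\ge0,\\ \alpha_{-g-h}(a)\,b, & g+h<0,\ g>0,\\ L_h(ab), & g+h<0,\ h>0,\\ \alpha_{-h}(a)\,b, & g+h<0,\ g,h\le0,\end{cases}$$ where $a\delta_g$ is the family with the single entry $a$ in degree $g$. The crossed product $\mathcal A\rtimes_\alpha\Gamma$ is the enveloping C*-algebra of $l_1(\Gamma,\alpha,\mathcal A)$. For $x\in\Gamma^+$ let $u_x$ (resp. $u_{-x}$) be the element of $\mathcal A\rtimes_\alpha\Gamma$ corresponding to $\alpha_x(1)\delta_x$ (resp. $\alpha_x(1)\delta_{-x}$),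 and write $a$ for the element of $\mathcal A\rtimes_\alpha\Gamma$ corresponding to $a\delta_0$, $a\in\mathcal A$. Then: (i) $\{u_x\}_{x\in\Gamma^+}$ is a semigroup of partial isometries: $u_{x+y}=u_xu_y$ and $u_xu_x^*u_x=u_x$ for all $x,y\in\Gamma^+$. (ii) For all $x\in\Gamma^+$ and $a\in\mathcal A$: $u_x^*=u_{-x}$, $u_xau_x^*=\alpha_x(a)$ and $u_x^*au_x=L_x(a)$. (iii) The elements of the form $$a=\sum_{x\in F}u_x^*a_{-x}+a_0+\sum_{x\in F}a_xu_x,\qquad F\subset\Gamma^+\setminus\{0\}\ \text{finite},$$ where $a_0\in\mathcal A$ and, for $x\in F$, $a_x,a_{-x}\in\mathcal A$ with $a_x\in\mathcal Au_xu_x^*$ and $a_{-x}\in u_xu_x^*\mathcal A$, form a dense $*$-subalgebra $C_0$ of $\mathcal A\rtimes_\alpha\Gamma$. (iv) If $a$ is of this form, and $a_g:=0$ for $g\notin\{0\}\cup F\cup(-F)$, then $\|a_g\|\le\|a\|$ for every $g\in\Gamma$, where $\|a_g\|$ is the norm in $\mathcal A$. In particular, the coefficients $a_g$, $g\in\Gamma$,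 are uniquely determined by $a$. -/

import Mathlib

open scoped ENNReal

noncomputable section

universe u v w

/-! ## Enveloping C*-algebras -/

/-- A contractive `*`-representation of a normed `*`-algebra `B` on a Hilbert space.
(For a Banach `*`-algebra every `*`-representation is automatically contractive.) -/
structure StarRepresentation (B : Type w) [NonUnitalNonAssocRing B] [Module ℂ B] [Star B]
    [Norm B] where
  /-- the Hilbert space -/
  space : Type w
  [normed : NormedAddCommGroup space]
  [inner : InnerProductSpace ℂ space]
  [complete : CompleteSpace space]
  /-- the `*`-homomorphism into the bounded operators -/
  hom : B →⋆ₙₐ[ℂ] (space →L[ℂ] space)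
  norm_le : ∀ b, ‖hom b‖ ≤ ‖b‖

attribute [instance] StarRepresentation.normed StarRepresentation.inner
  StarRepresentation.complete

section Enveloping

variable (B : Type w) [NonUnitalNonAssocRing B] [Module ℂ B] [Star B] [Norm B]

/-- The C*-algebra of bounded families of operators, indexed by all representations of `B`. -/
def RepresentationProduct : Type (w + 1) :=
  lp (fun R : StarRepresentation B => R.space →L[ℂ] R.space) ∞

instance : NonUnitalCStarAlgebra (RepresentationProduct B) :=
  inferInstanceAs
    (NonUnitalCStarAlgebra (lp (fun R : StarRepresentation B => R.space →L[ℂ] R.space) ∞))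

theorem StarRepresentation.memℓp (b : B) :
    Memℓp (fun R : StarRepresentation B => R.hom b) ∞ :=
  memℓp_infty ⟨‖b‖, by rintro _ ⟨R, rfl⟩; exact R.norm_le b⟩

/-- The universal representation of `B`, the direct sum of all its representations; thus
`‖universalHom B b‖` is the supremum of `‖ρ b‖` over all representations `ρ` of `B`. -/
def universalHom : B →⋆ₙₐ[ℂ] RepresentationProduct B where
  toFun b := ⟨fun R => R.hom b, StarRepresentation.memℓp B b⟩
  map_smul' c b := Subtype.ext <| funext fun R => map_smul R.hom c b
  map_zero' := Subtype.ext <| funext fun R => map_zero R.hom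
  map_add' a b := Subtype.ext <| funext fun R => map_add R.hom a b
  map_mul' a b := Subtype.ext <| funext fun R => map_mul R.hom a b
  map_star' b := Subtype.ext <| funext fun R => map_star R.hom b

/-- The enveloping C*-algebra of `B`: the closure of the image of `B` under its universal
representation, that is, the Hausdorff completion of `B` with respect to the seminorm
`b ↦ sup ‖ρ b‖`, the supremum being taken over all representations `ρ`. -/
def EnvelopingCStarAlgebra : Type (w + 1) :=
  ↥(NonUnitalStarAlgHom.range (universalHom B)).topologicalClosure

instance : NonUnitalCStarAlgebra (EnvelopingCStarAlgebra B) :=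
  NonUnitalStarSubalgebra.nonUnitalCStarAlgebra
    (NonUnitalStarAlgHom.range (universalHom B)).topologicalClosure
    (h_closed := NonUnitalStarSubalgebra.isClosed_topologicalClosure _)

/-- The canonical `*`-homomorphism of `B` into its enveloping C*-algebra. -/
def toEnveloping : B →⋆ₙₐ[ℂ] EnvelopingCStarAlgebra B where
  toFun b := ⟨universalHom B b,
    NonUnitalStarSubalgebra.le_topologicalClosure _ ⟨b, rfl⟩⟩
  map_smul' c b := Subtype.ext (map_smul (universalHom B) c b)
  map_zero' := Subtype.ext (map_zero (universalHom B))
  map_add' a b := Subtype.ext (map_add (universalHom B) a b)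
  map_mul' a b := Subtype.ext (map_mul (universalHom B) a b)
  map_star' b := Subtype.ext (map_star (universalHom B) b)

end Enveloping

/-! ## C*-dynamical systems and transfer actions -/

/-- An action `α` of the positive cone `Γ⁺ = {x : Γ // 0 ≤ x}` of a totally ordered abelian group
by (not necessarily unital) `*`-endomorphisms of a unital C*-algebra. -/
structure CStarDynamicalSystem (Γ : Type v) [AddCommGroup Γ] [LinearOrder Γ]
    [IsOrderedAddMonoid Γ] (A : Type u) [CStarAlgebra A] where
  /-- the endomorphisms `α_x` -/
  α : {x : Γ // 0 ≤ x} → (A →⋆ₙₐ[ℂ] A)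
  map_zero : ∀ a, α 0 a = a
  map_add : ∀ x y a, α (x + y) a = α x (α y a)

variable {Γ : Type v} [AddCommGroup Γ] [LinearOrder Γ] [IsOrderedAddMonoid Γ]
  {A : Type u} [CStarAlgebra A]

namespace CStarDynamicalSystem

/-- Fine representability. As `A` is unital, non-degenerate representations of `A` are the
unital ones. (A finely representable system has a representation as required on a Hilbert space
of the present universe, so that the choice of the universe is no restriction.) -/
def FinelyRepresentable (S : CStarDynamicalSystem Γ A) : Prop :=
  ∃ (H : Type (max u v)) (_ : NormedAddCommGroup H) (_ : InnerProductSpace ℂ H)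
    (_ : CompleteSpace H) (π : A →⋆ₐ[ℂ] (H →L[ℂ] H)) (U : {x : Γ // 0 ≤ x} → (H →L[ℂ] H)),
    Function.Injective π ∧
    (∀ x y, U (x + y) = U x * U y) ∧
    (∀ x a, π (S.α x a) = U x * π a * star (U x)) ∧
    (∀ x a, star (U x) * π a * U x ∈ Set.range π) ∧
    (∀ x a, U x * π a = π (S.α x a) * U x)

/-- A complete transfer action `L` for the dynamical system: an action by continuous, linear,
positive maps satisfying the transfer identity and the completeness identity. -/
structure CompleteTransferAction (S : CStarDynamicalSystem Γ A) where
  /-- the transfer operators `L_x` -/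
  L : {x : Γ // 0 ≤ x} → (A →L[ℂ] A)
  map_add : ∀ x y a, L (x + y) a = L y (L x a)
  positive : ∀ x a, ∃ b, L x (star a * a) = star b * b
  transfer : ∀ x a b, L x (S.α x a * b) = a * L x b
  complete : ∀ x a, S.α x (L x a) = S.α x 1 * a * S.α x 1

variable (S : CStarDynamicalSystem Γ A)

theorem α_one_mul_self (x : {x : Γ // 0 ≤ x}) : S.α x 1 * S.α x 1 = S.α x 1 := by
  rw [← map_mul, one_mul]

theorem star_α_one (x : {x : Γ // 0 ≤ x}) : star (S.α x 1) = S.α x 1 := by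
  rw [← map_star, star_one]

theorem norm_α_le (x : {x : Γ // 0 ≤ x}) (a : A) : ‖S.α x a‖ ≤ ‖a‖ :=
  NonUnitalStarAlgHom.norm_apply_le (S.α x) a

theorem norm_le_one_of_proj {B : Type*} [NonUnitalNormedRing B] [StarRing B] [CStarRing B]
    {p : B} (h1 : star p = p) (h2 : p * p = p) : ‖p‖ ≤ 1 := by
  have h : ‖p‖ = ‖p‖ * ‖p‖ := by
    conv_lhs => rw [← h2]
    conv_lhs => arg 1; arg 1; rw [← h1]
    exact CStarRing.norm_star_mul_self
  by_contra! h3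
  nlinarith

namespace CompleteTransferAction

variable {S}
variable (T : S.CompleteTransferAction) (x : {x : Γ // 0 ≤ x})

theorem L_star (a : A) : T.L x (star a) = star (T.L x a) := by
  have key : ∀ h : A, star h = h → star (T.L x h) = T.L x h := by
    intro h hh
    obtain ⟨b, hb⟩ := T.positive x (h + 1)
    obtain ⟨c, hc⟩ := T.positive x (h - 1)
    have e : h = (1 / 4 : ℂ) • (star (h + 1) * (h + 1) - star (h - 1) * (h - 1)) := by
      rw [star_add, star_sub, hh, star_one]
      have : (h + 1) * (h + 1) - (h - 1) * (h - 1) = (4 : ℂ) • h := by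
        rw [show (4 : ℂ) = ((4 : ℕ) : ℂ) by norm_num, Nat.cast_smul_eq_nsmul]
        noncomm_ring
      rw [this, smul_smul]; norm_num
    rw [e, map_smul, map_sub, hb, hc]
    simp [star_smul, star_sub, star_mul]
  have ha : a = (realPart a : A) + Complex.I • (imaginaryPart a : A) :=
    (realPart_add_I_smul_imaginaryPart a).symm
  have h1 := key (realPart a : A) (realPart a).2
  have h2 := key (imaginaryPart a : A) (imaginaryPart a).2
  have h3 : star (realPart a : A) = (realPart a : A) := (realPart a).2
  have h4 : star (imaginaryPart a : A) = (imaginaryPart a : A) := (imaginaryPart a).2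
  rw [ha]
  simp only [star_add, star_smul, _root_.map_add, map_smul, h1, h2, h3, h4]

theorem transfer_right (a b : A) : T.L x (b * S.α x a) = T.L x b * a := by
  have h := T.transfer x (star a) (star b)
  have h' := congrArg star h
  rw [← T.L_star, star_mul, star_star, star_mul, ← T.L_star, star_star, ← StarHomClass.map_star,
    star_star] at h'
  exact h'

theorem L_one_mul_left (a : A) : T.L x (S.α x 1 * a) = T.L x a := by
  rw [T.transfer, one_mul]

theorem L_one_mul_right (a : A) : T.L x (a * S.α x 1) = T.L x a := by
  rw [T.transfer_right, mul_one]

theorem norm_L_le (a : A) : ‖T.L x a‖ ≤ ‖a‖ := by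
  let _ : PartialOrder A := CStarAlgebra.spectralOrder A
  let _ : StarOrderedRing A := CStarAlgebra.spectralOrderedRing A
  have hpos : ∀ b : A, 0 ≤ b → 0 ≤ T.L x b := by
    intro b hb
    obtain ⟨c, rfl⟩ := CStarAlgebra.nonneg_iff_eq_star_mul_self.mp hb
    obtain ⟨d, hd⟩ := T.positive x c
    rw [hd]; exact star_mul_self_nonneg d
  have hone : ‖T.L x 1‖ ≤ 1 := by
    apply norm_le_one_of_proj
    · rw [← T.L_star, star_one]
    · rw [← T.transfer_right, T.complete, one_mul, mul_one, α_one_mul_self]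
      simpa using T.L_one_mul_left x 1
  have e : star (T.L x a) * T.L x a = T.L x (star a * (S.α x 1 * a)) := by
    rw [← T.L_star, ← T.transfer_right, T.complete, ← mul_assoc, L_one_mul_right]
  have hp : ‖S.α x 1 * a‖ ≤ ‖a‖ := by
    have := norm_le_one_of_proj (S.star_α_one x) (S.α_one_mul_self x)
    calc _ ≤ ‖S.α x 1‖ * ‖a‖ := norm_mul_le _ _
      _ ≤ 1 * ‖a‖ := by gcongr
      _ = ‖a‖ := one_mul _
  set c := S.α x 1 * a with hc
  have e2 : star a * (S.α x 1 * a) = star c * c := by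
    rw [hc, star_mul, S.star_α_one, mul_assoc, ← mul_assoc (S.α x 1) (S.α x 1),
      S.α_one_mul_self]
  have h1 : star c * c ≤ algebraMap ℝ A (‖c‖ * ‖c‖) := by
    rw [← CStarRing.norm_star_mul_self]
    exact IsSelfAdjoint.le_algebraMap_norm_self (IsSelfAdjoint.star_mul_self c)
  have h2 : T.L x (star c * c) ≤ T.L x (algebraMap ℝ A (‖c‖ * ‖c‖)) := by
    have := hpos _ (sub_nonneg.mpr h1)
    rwa [map_sub, sub_nonneg] at this
  have h3 : ‖T.L x (star c * c)‖ ≤ ‖c‖ * ‖c‖ := by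
    calc _ ≤ ‖T.L x (algebraMap ℝ A (‖c‖ * ‖c‖))‖ :=
          CStarAlgebra.norm_le_norm_of_nonneg_of_le (hpos _ (star_mul_self_nonneg c)) h2
      _ = ‖c‖ * ‖c‖ * ‖T.L x 1‖ := by
          rw [Algebra.algebraMap_eq_smul_one]
          rw [show ((‖c‖ * ‖c‖ : ℝ) • (1 : A)) = ((‖c‖ * ‖c‖ : ℝ) : ℂ) • (1 : A) from
            (RCLike.real_smul_eq_coe_smul (K := ℂ) _ _)]
          rw [map_smul, norm_smul]
          simp
      _ ≤ ‖c‖ * ‖c‖ * 1 := by gcongr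
      _ = _ := mul_one _
  have h4 : ‖T.L x a‖ * ‖T.L x a‖ ≤ ‖a‖ * ‖a‖ := by
    rw [← CStarRing.norm_star_mul_self, e, e2]
    exact h3.trans (by gcongr)
  exact abs_le_of_sq_le_sq' (by nlinarith) (norm_nonneg a) |>.2

/-- A complete transfer action is unique. -/
instance : Subsingleton S.CompleteTransferAction := by
  constructor
  intro T T'
  have key : ∀ (T T' : S.CompleteTransferAction) x a, T'.L x a = T.L x a * T'.L x 1 := by
    intro T T' x a
    have h := T'.transfer x (T.L x a) 1
    rw [mul_one, T.complete, L_one_mul_right, L_one_mul_left] at h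
    exact h
  have hone : ∀ x, T.L x 1 = T'.L x 1 := by
    intro x
    have h1 := key T T' x 1
    have h2 := congrArg star (key T' T x 1)
    rw [star_mul, ← T.L_star, ← T'.L_star, star_one] at h2
    rw [h2, ← h1]
  have hL : T.L = T'.L := by
    funext x
    ext a
    rw [key T T' x a, ← hone, ← key T T x a]
  cases T; cases T'; cases hL; rfl

end CompleteTransferAction

/-- A finely representable system has a complete transfer action. -/
theorem FinelyRepresentable.nonempty {S : CStarDynamicalSystem Γ A}
    (hS : S.FinelyRepresentable) : Nonempty S.CompleteTransferAction := by
  obtain ⟨H, _, _, _, π, U, hinj, hU, h1, h2, h3⟩ := hS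
  choose l hl using h2
  have hiso : ∀ a, ‖π a‖ = ‖a‖ := fun a => NonUnitalStarAlgHom.norm_map π hinj a
  have hUU : ∀ x, U x * star (U x) = π (S.α x 1) := fun x => by
    rw [h1, map_one, mul_one]
  have hnU : ∀ x, ‖U x‖ ≤ 1 := by
    intro x
    have : ‖U x‖ * ‖U x‖ ≤ 1 := by
      rw [← CStarRing.norm_self_mul_star, hUU, hiso]
      exact norm_le_one_of_proj (S.star_α_one x) (S.α_one_mul_self x)
    by_contra! h
    nlinarith
  have hll : ∀ x a, π (l x a) = star (U x) * π a * U x := hl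
  have hnl : ∀ x a, ‖l x a‖ ≤ 1 * ‖a‖ := by
    intro x a
    rw [← hiso, hll]
    calc _ ≤ ‖star (U x)‖ * ‖π a‖ * ‖U x‖ :=
          (norm_mul_le _ _).trans (by gcongr; exact norm_mul_le _ _)
      _ ≤ 1 * ‖a‖ * 1 := by
          rw [norm_star, hiso]
          gcongr
          · exact hnU x
          · exact hnU x
      _ = _ := mul_one _
  let L : {x : Γ // 0 ≤ x} → (A →L[ℂ] A) := fun x =>
    LinearMap.mkContinuous
      { toFun := l x
        map_add' := fun a b => hinj (by
          rw [_root_.map_add, hll, hll, hll, _root_.map_add]; noncomm_ring)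
        map_smul' := fun c a => hinj (by
          rw [RingHom.id_apply, map_smul, hll, hll, map_smul, mul_smul_comm, smul_mul_assoc]) }
      1 (hnl x)
  have hL : ∀ x a, π (L x a) = star (U x) * π a * U x := hll
  refine ⟨⟨L, ?_, ?_, ?_, ?_⟩⟩
  · intro x y a
    apply hinj
    rw [hL, hL, hL, hU, star_mul]
    noncomm_ring
  · intro x a
    let _ : PartialOrder A := CStarAlgebra.spectralOrder A
    let _ : StarOrderedRing A := CStarAlgebra.spectralOrderedRing A
    suffices h : 0 ≤ L x (star a * a) from
      CStarAlgebra.nonneg_iff_eq_star_mul_self.mp h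
    have hpos : π (L x (star a * a)) = star (π a * U x) * (π a * U x) := by
      rw [hL, map_mul, StarHomClass.map_star, star_mul]
      noncomm_ring
    have hsa : IsSelfAdjoint (L x (star a * a)) := by
      apply hinj
      rw [StarHomClass.map_star, hpos, star_mul, star_star]
    rw [StarOrderedRing.nonneg_iff_spectrum_nonneg (R := ℝ) _ hsa,
      ← hsa.map_spectrum_real π hinj]
    intro r hr
    refine spectrum_nonneg_of_nonneg ?_ hr
    rw [hpos]
    exact star_mul_self_nonneg _
  · intro x a b
    apply hinj
    rw [hL, map_mul, map_mul, hL]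
    have := congrArg star (h3 x (star a))
    simp only [star_mul, ← StarHomClass.map_star, star_star] at this
    rw [← mul_assoc, ← this]
    noncomm_ring
  · intro x a
    apply hinj
    rw [h1, hL, map_mul, map_mul, ← hUU]
    noncomm_ring

/-- The unique complete transfer action of a finely representable system. -/
def FinelyRepresentable.transferAction {S : CStarDynamicalSystem Γ A}
    (hS : S.FinelyRepresentable) : S.CompleteTransferAction :=
  Classical.choice hS.nonempty

/-! ## The algebra `l₁(Γ, α, A)` -/

/-- The absolute value of `g : Γ`, as an element of the positive cone `Γ⁺`. -/
def absPos (g : Γ) : {x : Γ // 0 ≤ x} := ⟨|g|, abs_nonneg g⟩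

/-- The space of coefficients of degree `g`: it is `A α_g(1)` for `0 ≤ g` and
`α_{-g}(1) A` for `g < 0`. -/
def coeffSpace (S : CStarDynamicalSystem Γ A) (g : Γ) : Submodule ℂ A :=
  if 0 ≤ g then LinearMap.range (LinearMap.mulRight ℂ (S.α (absPos g) 1))
  else LinearMap.range (LinearMap.mulLeft ℂ (S.α (absPos g) 1))

theorem mem_coeffSpace_of_nonneg {g : Γ} (hg : 0 ≤ g) {a : A} :
    a ∈ S.coeffSpace g ↔ a * S.α (absPos g) 1 = a := by
  rw [coeffSpace, if_pos hg]
  constructor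
  · rintro ⟨b, rfl⟩
    simp [mul_assoc, α_one_mul_self]
  · intro h
    exact ⟨a, h⟩

theorem mem_coeffSpace_of_nonpos {g : Γ} (hg : g ≤ 0) {a : A} :
    a ∈ S.coeffSpace g ↔ S.α (absPos g) 1 * a = a := by
  rcases hg.eq_or_lt with rfl | hg
  · rw [mem_coeffSpace_of_nonneg S le_rfl]
    have : (absPos (0 : Γ)) = 0 := Subtype.ext abs_zero
    simp [this, S.map_zero]
  rw [coeffSpace, if_neg hg.not_ge]
  constructor
  · rintro ⟨b, rfl⟩
    simp [← mul_assoc, α_one_mul_self]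
  · intro h
    exact ⟨a, h⟩

theorem star_mem_coeffSpace {g : Γ} {a : A} (ha : a ∈ S.coeffSpace (-g)) :
    star a ∈ S.coeffSpace g := by
  have habs : absPos (-g) = absPos g := Subtype.ext (abs_neg g)
  rcases le_total 0 g with hg | hg
  · rw [mem_coeffSpace_of_nonpos S (neg_nonpos.mpr hg), habs] at ha
    rw [mem_coeffSpace_of_nonneg S hg, ← S.star_α_one, ← star_mul, ha]
  · rw [mem_coeffSpace_of_nonneg S (neg_nonneg.mpr hg), habs] at ha
    rw [mem_coeffSpace_of_nonpos S hg, ← S.star_α_one, ← star_mul, ha]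

theorem α_one_mem_coeffSpace (g : Γ) : S.α (absPos g) 1 ∈ S.coeffSpace g := by
  rcases le_total 0 g with hg | hg
  · rw [mem_coeffSpace_of_nonneg S hg, α_one_mul_self]
  · rw [mem_coeffSpace_of_nonpos S hg, α_one_mul_self]

theorem mem_coeffSpace_zero (a : A) : a ∈ S.coeffSpace 0 := by
  have : (absPos (0 : Γ)) = 0 := Subtype.ext abs_zero
  rw [mem_coeffSpace_of_nonneg S le_rfl, this, S.map_zero, mul_one]

namespace CompleteTransferAction

variable {S}
variable (T : S.CompleteTransferAction)

/-- The coefficient of the product `(a δ_g) (b δ_h)`, an element of degree `g + h`. -/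
def mulCoeff (g h : Γ) (a b : A) : A :=
  if 0 ≤ g + h then
    if h < 0 then a * S.α (absPos (g + h)) b
    else if g < 0 then T.L (absPos g) (a * b)
    else a * S.α (absPos g) b
  else
    if 0 < g then S.α (absPos (g + h)) a * b
    else if 0 < h then T.L (absPos h) (a * b)
    else S.α (absPos h) a * b

theorem mulCoeff_add_left (g h : Γ) (a a' b : A) :
    T.mulCoeff g h (a + a') b = T.mulCoeff g h a b + T.mulCoeff g h a' b := by
  unfold mulCoeff
  split_ifs <;> simp only [_root_.map_add, add_mul]

theorem mulCoeff_add_right (g h : Γ) (a b b' : A) :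
    T.mulCoeff g h a (b + b') = T.mulCoeff g h a b + T.mulCoeff g h a b' := by
  unfold mulCoeff
  split_ifs <;> simp only [_root_.map_add, mul_add]

theorem mulCoeff_zero_left (g h : Γ) (b : A) : T.mulCoeff g h 0 b = 0 := by
  have := T.mulCoeff_add_left g h 0 0 b
  simpa using this

theorem mulCoeff_zero_right (g h : Γ) (a : A) : T.mulCoeff g h a 0 = 0 := by
  have := T.mulCoeff_add_right g h a 0 0
  simpa using this

theorem norm_mulCoeff_le (g h : Γ) (a b : A) : ‖T.mulCoeff g h a b‖ ≤ ‖a‖ * ‖b‖ := by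
  unfold mulCoeff
  split_ifs
  all_goals first
    | exact (T.norm_L_le _ _).trans (norm_mul_le _ _)
    | refine (norm_mul_le _ _).trans ?_
      gcongr
      exact S.norm_α_le _ _

theorem mulCoeff_mem {g h : Γ} {a b : A} (ha : a ∈ S.coeffSpace g) (hb : b ∈ S.coeffSpace h) :
    T.mulCoeff g h a b ∈ S.coeffSpace (g + h) := by
  unfold mulCoeff
  split_ifs with h1 h2 h3 h4 h5
  · rw [mem_coeffSpace_of_nonneg S h1, mul_assoc, ← map_mul, mul_one]
  · rw [mem_coeffSpace_of_nonneg S (not_lt.mp h2)] at hb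
    have e : absPos h = absPos g + absPos (g + h) := Subtype.ext (by
      simp [absPos, abs_of_nonneg h1, abs_of_neg h3, abs_of_nonneg (not_lt.mp h2)])
    rw [mem_coeffSpace_of_nonneg S h1, ← T.transfer_right, ← S.map_add, ← e, mul_assoc, hb]
  · rw [mem_coeffSpace_of_nonneg S (not_lt.mp h2)] at hb
    have e : absPos (g + h) = absPos g + absPos h := Subtype.ext (by
      simp [absPos, abs_of_nonneg h1, abs_of_nonneg (not_lt.mp h3),
        abs_of_nonneg (not_lt.mp h2)])
    rw [mem_coeffSpace_of_nonneg S h1, e, S.map_add, mul_assoc, ← map_mul, hb]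
  · rw [mem_coeffSpace_of_nonpos S (not_le.mp h1).le, ← mul_assoc, ← map_mul, one_mul]
  · have hg : g ≤ 0 := not_lt.mp h4
    rw [mem_coeffSpace_of_nonpos S hg] at ha
    have e : absPos g = absPos h + absPos (g + h) := Subtype.ext (by
      simp [absPos, abs_of_neg (not_le.mp h1), abs_of_nonpos hg, abs_of_pos h5])
    rw [mem_coeffSpace_of_nonpos S (not_le.mp h1).le, ← T.transfer, ← S.map_add, ← e,
      ← mul_assoc, ha]
  · have hg : g ≤ 0 := not_lt.mp h4
    rw [mem_coeffSpace_of_nonpos S hg] at ha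
    have e : absPos (g + h) = absPos h + absPos g := Subtype.ext (by
      simp [absPos, abs_of_neg (not_le.mp h1), abs_of_nonpos hg, abs_of_nonpos (not_lt.mp h5)])
    rw [mem_coeffSpace_of_nonpos S (not_le.mp h1).le, e, S.map_add, ← mul_assoc, ← map_mul, ha]

/-- The subspace of `ℓ¹(Γ, A)` of the families `a` with `a_x ∈ A α_x(1)` and
`a_{-x} ∈ α_x(1) A` for `x ∈ Γ⁺`. -/
def ellOneSubmodule (_T : S.CompleteTransferAction) : Submodule ℂ (lp (fun _ : Γ => A) 1) where
  carrier := {a | ∀ g, a g ∈ S.coeffSpace g}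
  add_mem' ha hb g := (S.coeffSpace g).add_mem (ha g) (hb g)
  zero_mem' g := (S.coeffSpace g).zero_mem
  smul_mem' c _ ha g := (S.coeffSpace g).smul_mem c (ha g)

/-- The space `l₁(Γ, α, A)`, with norm `‖a‖ = ∑ ‖a_g‖`. Its product depends on the transfer
action. -/
def EllOne : Type (max u v) := ↥T.ellOneSubmodule

instance : NormedAddCommGroup T.EllOne := inferInstanceAs (NormedAddCommGroup T.ellOneSubmodule)

instance : NormedSpace ℂ T.EllOne := inferInstanceAs (NormedSpace ℂ T.ellOneSubmodule)

namespace EllOne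

variable {T}

/-- The coefficient of degree `g`. -/
def coeff (a : T.EllOne) (g : Γ) : A := a.1 g

theorem coeff_mem (a : T.EllOne) (g : Γ) : a.coeff g ∈ S.coeffSpace g := a.2 g

theorem ext {a b : T.EllOne} (h : ∀ g, a.coeff g = b.coeff g) : a = b :=
  Subtype.ext (lp.ext (funext h))

theorem summable_norm (a : T.EllOne) : Summable fun g => ‖a.coeff g‖ := by
  have h := (lp.memℓp a.1).summable (by simp)
  simp only [ENNReal.toReal_one, Real.rpow_one] at h
  exact h

theorem norm_eq (a : T.EllOne) : ‖a‖ = ∑' g, ‖a.coeff g‖ := by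
  have h := lp.norm_eq_tsum_rpow (p := 1) (by simp) a.1
  simp only [ENNReal.toReal_one, Real.rpow_one, div_one] at h
  exact h

theorem norm_coeff_le (a : T.EllOne) (g : Γ) : ‖a.coeff g‖ ≤ ‖a‖ := by
  rw [norm_eq]
  exact a.summable_norm.le_tsum g fun _ _ => norm_nonneg _

/-- A summable family of coefficients as an element of `l₁(Γ, α, A)`. -/
def mk (c : Γ → A) (hc : ∀ g, c g ∈ S.coeffSpace g) (hs : Summable fun g => ‖c g‖) : T.EllOne :=
  ⟨⟨c, memℓp_gen (by simpa using hs)⟩, hc⟩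

theorem coeff_mk (c : Γ → A) (hc) (hs) (g : Γ) : (mk c hc hs : T.EllOne).coeff g = c g := rfl

theorem coeff_add (a b : T.EllOne) (g : Γ) : (a + b).coeff g = a.coeff g + b.coeff g := rfl

theorem coeff_zero (g : Γ) : (0 : T.EllOne).coeff g = 0 := rfl

theorem coeff_smul (c : ℂ) (a : T.EllOne) (g : Γ) : (c • a).coeff g = c • a.coeff g := rfl

/-- The involution `(a*)_g = (a_{-g})*`. -/
instance : Star T.EllOne where
  star a := mk (fun g => star (a.coeff (-g))) (fun g => S.star_mem_coeffSpace (a.coeff_mem (-g)))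
    (by
      simp only [norm_star]
      exact (Equiv.neg Γ).summable_iff.mpr a.summable_norm)

theorem coeff_star (a : T.EllOne) (g : Γ) : (star a).coeff g = star (a.coeff (-g)) := rfl

theorem summable_mul_norm (a b : T.EllOne) :
    Summable fun p : Γ × Γ => ‖a.coeff p.2‖ * ‖b.coeff (p.1 - p.2)‖ := by
  have h := a.summable_norm.mul_of_nonneg b.summable_norm (fun _ => norm_nonneg _)
    (fun _ => norm_nonneg _)
  let e : Γ × Γ ≃ Γ × Γ :=
    { toFun := fun p => (p.2, p.1 - p.2)
      invFun := fun q => (q.2 + q.1, q.1)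
      left_inv := fun p => by simp
      right_inv := fun q => by simp }
  exact e.summable_iff.mpr h

theorem summable_norm_mulCoeff (a b : T.EllOne) (g : Γ) :
    Summable fun h => ‖T.mulCoeff h (g - h) (a.coeff h) (b.coeff (g - h))‖ :=
  Summable.of_nonneg_of_le (fun _ => norm_nonneg _) (fun _ => T.norm_mulCoeff_le _ _ _ _)
    ((summable_mul_norm a b).prod_factor g)

theorem summable_mulCoeff (a b : T.EllOne) (g : Γ) :
    Summable fun h => T.mulCoeff h (g - h) (a.coeff h) (b.coeff (g - h)) :=
  (summable_norm_mulCoeff a b g).of_norm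

/-- The product of `l₁(Γ, α, A)`. -/
instance : Mul T.EllOne where
  mul a b := mk (fun g => ∑' h, T.mulCoeff h (g - h) (a.coeff h) (b.coeff (g - h)))
    (by
      intro g
      have hm : ∀ h, T.mulCoeff h (g - h) (a.coeff h) (b.coeff (g - h)) ∈ S.coeffSpace g := by
        intro h
        have := T.mulCoeff_mem (a.coeff_mem h) (b.coeff_mem (g - h))
        rwa [add_sub_cancel] at this
      have hs := summable_mulCoeff a b g
      rcases le_total 0 g with hg | hg
      · rw [mem_coeffSpace_of_nonneg S hg, ← hs.tsum_mul_right]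
        exact tsum_congr fun h => (mem_coeffSpace_of_nonneg S hg).mp (hm h)
      · rw [mem_coeffSpace_of_nonpos S hg, ← hs.tsum_mul_left]
        exact tsum_congr fun h => (mem_coeffSpace_of_nonpos S hg).mp (hm h))
    (Summable.of_nonneg_of_le (fun _ => norm_nonneg _)
      (fun g => (norm_tsum_le_tsum_norm (summable_norm_mulCoeff a b g)).trans
        ((summable_norm_mulCoeff a b g).tsum_le_tsum (fun _ => T.norm_mulCoeff_le _ _ _ _)
          ((summable_mul_norm a b).prod_factor g)))
      (summable_mul_norm a b).prod)

theorem coeff_mul (a b : T.EllOne) (g : Γ) : (a * b).coeff g =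
    ∑' h, T.mulCoeff h (g - h) (a.coeff h) (b.coeff (g - h)) := rfl

instance : NonUnitalNonAssocRing T.EllOne :=
  { (inferInstance : AddCommGroup T.EllOne), (inferInstance : Mul T.EllOne) with
    left_distrib := fun a b c => ext fun g => by
      rw [coeff_add, coeff_mul, coeff_mul, coeff_mul,
        ← (summable_mulCoeff a b g).tsum_add (summable_mulCoeff a c g)]
      exact tsum_congr fun h => by rw [coeff_add, mulCoeff_add_right]
    right_distrib := fun a b c => ext fun g => by
      rw [coeff_add, coeff_mul, coeff_mul, coeff_mul,
        ← (summable_mulCoeff a c g).tsum_add (summable_mulCoeff b c g)]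
      exact tsum_congr fun h => by rw [coeff_add, mulCoeff_add_left]
    zero_mul := fun a => ext fun g => by
      rw [coeff_mul, coeff_zero]
      simp only [coeff_zero, mulCoeff_zero_left, tsum_zero]
    mul_zero := fun a => ext fun g => by
      rw [coeff_mul, coeff_zero]
      simp only [coeff_zero, mulCoeff_zero_right, tsum_zero] }

open Classical in
/-- The element `a δ_g`, for `a` in the coefficient space of degree `g`. -/
def delta (T : S.CompleteTransferAction) (g : Γ) (a : A) (ha : a ∈ S.coeffSpace g) : T.EllOne :=
  mk (fun h => if h = g then a else 0)
    (fun h => by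
      split_ifs with hh
      · rw [hh]; exact ha
      · exact (S.coeffSpace h).zero_mem)
    (summable_of_ne_finset_zero (s := {g}) fun h hh => by
      rw [if_neg (by simpa using hh), norm_zero])

end EllOne

/-! ## The crossed product -/

/-- The crossed product of `A` by the action: the enveloping C*-algebra of `l₁(Γ, α, A)`. -/
abbrev CrossedProduct : Type (max u v + 1) := EnvelopingCStarAlgebra T.EllOne

/-- The element of the crossed product corresponding to `a δ_0`. -/
def ofCoeff (a : A) : T.CrossedProduct :=
  toEnveloping T.EllOne (EllOne.delta T 0 a (S.mem_coeffSpace_zero a))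

/-- The element `u_g` of the crossed product corresponding to `α_{|g|}(1) δ_g`; that is, for
`x ∈ Γ⁺`, `u_x` corresponds to `α_x(1) δ_x` and `u_{-x}` to `α_x(1) δ_{-x}`. -/
def u (g : Γ) : T.CrossedProduct :=
  toEnveloping T.EllOne (EllOne.delta T g (S.α (absPos g) 1) (S.α_one_mem_coeffSpace g))

/-- `T.IsFourierSum F c a` says that `F` is a finite subset of `Γ⁺ \ {0}`, that the coefficients
`c_g` of `A` satisfy `c_x ∈ A u_x u_x*` and `c_{-x} ∈ u_x u_x* A` for `x ∈ F` (as elements of the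
crossed product) and vanish for all `g` outside `{0} ∪ F ∪ -F`, and that
`a = ∑ u_x* c_{-x} + c_0 + ∑ c_x u_x`, the sums being taken over `x ∈ F`. -/
structure IsFourierSum (F : Finset {x : Γ // 0 ≤ x}) (c : Γ → A) (a : T.CrossedProduct) :
    Prop where
  zero_notMem : 0 ∉ F
  coeff_pos : ∀ x ∈ F, ∃ b : A,
    T.ofCoeff (c (x : Γ)) = T.ofCoeff b * (T.u (x : Γ) * star (T.u (x : Γ)))
  coeff_neg : ∀ x ∈ F, ∃ b : A,
    T.ofCoeff (c (-(x : Γ))) = T.u (x : Γ) * star (T.u (x : Γ)) * T.ofCoeff b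
  coeff_eq_zero : ∀ g : Γ, g ≠ 0 → (∀ x ∈ F, g ≠ (x : Γ) ∧ g ≠ -(x : Γ)) → c g = 0
  eq_sum : a = ∑ x ∈ F, star (T.u (x : Γ)) * T.ofCoeff (c (-(x : Γ))) + T.ofCoeff (c 0) +
    ∑ x ∈ F, T.ofCoeff (c (x : Γ)) * T.u (x : Γ)

end CompleteTransferAction

end CStarDynamicalSystem

end

/-! The relations among the $u_x$ and the elements of $\mathcal A$ are computations with one-term
families $a\delta_g$, since `toEnveloping` is a $*$-homomorphism. The substance is the estimate
$\|a_g\|\le\|a\|$: the enveloping norm must not shrink coefficients. As this norm is a supremum over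
all representations, one good representation is enough.

A fine representation $(\pi,U)$ on $H$ also implements the given transfer operators,
$\pi(L_x(a))=U_x^*\pi(a)U_x$, by the algebra behind their uniqueness
(`FinelyRepresentable.exists_covariantRepresentation`). Let $b\delta_g$ act on $H$ by
$V_g(b)=\pi(b)U_g$ for $g\ge0$ and $V_g(b)=U_{-g}^*\pi(b)$ for $g\le0$. This respects the product
case by case (`fiberFun_mul`) and is isometric on each coefficient space (`norm_fiberFun`).
Different degrees may still interfere on $H$, so they are separated on $\ell^2(\Gamma,H)$ by
tensoring $V_g(b)$ with the translation by $g$. The resulting regular representation sends a vector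
supported at $0$ to one whose component at $g$ is $V_g(a_g)\xi$; hence it dominates every $\|a_g\|$.

So `toEnveloping` is injective, and conditions on coefficients stated in the crossed product descend
to $\mathcal A$. The Fourier sums are then exactly the image of the finitely supported families, a
dense $*$-subalgebra of $l_1$. -/

noncomputable section

/-! ### Operator-weighted translations on $\ell^2(\Gamma,H)$. -/

section Shift

variable {Γ : Type*} [AddCommGroup Γ] {H : Type*} [NormedAddCommGroup H]

theorem hasSum_lpShift_bound (g : Γ) (C : ℝ) (ξ : lp (fun _ : Γ => H) 2) :
    HasSum (fun k => C ^ 2 * ‖ξ (k - g)‖ ^ 2) (C ^ 2 * ‖ξ‖ ^ 2) := by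
  have h := lp.hasSum_norm (p := 2) (by simp) ξ
  simp only [ENNReal.toReal_ofNat, Real.rpow_ofNat] at h
  exact ((Equiv.subRight g).hasSum_iff.mpr h).mul_left _

variable [InnerProductSpace ℂ H]

theorem norm_sq_lpShift_le (g : Γ) (A : H →L[ℂ] H) (ξ : lp (fun _ : Γ => H) 2) (k : Γ) :
    ‖A (ξ (k - g))‖ ^ 2 ≤ ‖A‖ ^ 2 * ‖ξ (k - g)‖ ^ 2 := by
  rw [← mul_pow]
  gcongr
  exact A.le_opNorm _

theorem summable_lpShift (g : Γ) (A : H →L[ℂ] H) (ξ : lp (fun _ : Γ => H) 2) :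
    Summable fun k => ‖A (ξ (k - g))‖ ^ 2 :=
  (hasSum_lpShift_bound g ‖A‖ ξ).summable.of_nonneg_of_le (fun _ => by positivity)
    (norm_sq_lpShift_le g A ξ)

/-- The linear map `(ξ_k) ↦ (A ξ_{k - g})` on `ℓ²(Γ, H)`. -/
def lpShiftₗ (g : Γ) (A : H →L[ℂ] H) :
    lp (fun _ : Γ => H) 2 →ₗ[ℂ] lp (fun _ : Γ => H) 2 where
  toFun ξ := ⟨fun k => A (ξ (k - g)), memℓp_gen (by simpa using summable_lpShift g A ξ)⟩
  map_add' ξ η := lp.ext (funext fun k => A.map_add _ _)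
  map_smul' c ξ := lp.ext (funext fun k => A.map_smul _ _)

theorem norm_lpShiftₗ_le (g : Γ) (A : H →L[ℂ] H) (ξ : lp (fun _ : Γ => H) 2) :
    ‖lpShiftₗ g A ξ‖ ≤ ‖A‖ * ‖ξ‖ := by
  refine lp.norm_le_of_tsum_le (p := 2) (by simp) (by positivity) ?_
  simp only [ENNReal.toReal_ofNat, Real.rpow_ofNat, mul_pow]
  exact ((summable_lpShift g A ξ).tsum_le_tsum (norm_sq_lpShift_le g A ξ)
    (hasSum_lpShift_bound g ‖A‖ ξ).summable).trans_eq (hasSum_lpShift_bound g ‖A‖ ξ).tsum_eq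

/-- The operator `(ξ_k) ↦ (A ξ_{k - g})` on `ℓ²(Γ, H)`. -/
def lpShift (g : Γ) (A : H →L[ℂ] H) :
    lp (fun _ : Γ => H) 2 →L[ℂ] lp (fun _ : Γ => H) 2 :=
  (lpShiftₗ g A).mkContinuous ‖A‖ (norm_lpShiftₗ_le g A)

theorem lpShift_apply (g : Γ) (A : H →L[ℂ] H) (ξ : lp (fun _ : Γ => H) 2) (k : Γ) :
    lpShift g A ξ k = A (ξ (k - g)) := rfl

theorem norm_lpShift_le (g : Γ) (A : H →L[ℂ] H) : ‖lpShift g A‖ ≤ ‖A‖ :=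
  LinearMap.mkContinuous_norm_le _ (norm_nonneg _) _

theorem lpShift_mul (g h : Γ) (A B : H →L[ℂ] H) :
    lpShift g A * lpShift h B = lpShift (g + h) (A * B) := by
  ext ξ k
  simp only [mul_apply_eq_comp, lpShift_apply, sub_sub]

theorem star_lpShift [CompleteSpace H] (g : Γ) (A : H →L[ℂ] H) :
    star (lpShift g A) = lpShift (-g) (star A) := by
  symm
  rw [ContinuousLinearMap.star_eq_adjoint (lpShift g A), ContinuousLinearMap.eq_adjoint_iff]
  intro ξ η
  rw [lp.inner_eq_tsum, lp.inner_eq_tsum, ← (Equiv.subRight g).tsum_eq]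
  refine tsum_congr fun k => ?_
  simp only [lpShift_apply, Equiv.subRight_apply, sub_neg_eq_add, sub_add_cancel,
    ContinuousLinearMap.star_eq_adjoint, ContinuousLinearMap.adjoint_inner_left]

variable (H) in
/-- `lpShift` as a contractive linear map in the operator. -/
def lpShiftL (g : Γ) :
    (H →L[ℂ] H) →L[ℂ] (lp (fun _ : Γ => H) 2 →L[ℂ] lp (fun _ : Γ => H) 2) :=
  LinearMap.mkContinuous
    { toFun := fun A : H →L[ℂ] H => lpShift g A
      map_add' := fun A B => by ext ξ k; rfl
      map_smul' := fun c A => by ext ξ k; rfl }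
    1 fun A => by simpa using norm_lpShift_le g A

end Shift

/-! ### Covariant representations and their existence. -/

/-- A representation by operators which implement the action and its transfer operators. -/
structure CStarDynamicalSystem.CovariantRepresentation {Γ : Type v} [AddCommGroup Γ]
    [LinearOrder Γ] [IsOrderedAddMonoid Γ] {A : Type u} [CStarAlgebra A]
    {S : CStarDynamicalSystem Γ A} (T : S.CompleteTransferAction) (H : Type w)
    [NormedAddCommGroup H] [InnerProductSpace ℂ H] [CompleteSpace H] where
  /-- the representation of the coefficient algebra -/
  π : A →⋆ₐ[ℂ] (H →L[ℂ] H)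
  /-- the partial isometries -/
  U : {x : Γ // 0 ≤ x} → (H →L[ℂ] H)
  injective : Function.Injective π
  U_add : ∀ x y, U (x + y) = U x * U y
  map_α : ∀ x a, π (S.α x a) = U x * π a * star (U x)
  map_L : ∀ x a, π (T.L x a) = star (U x) * π a * U x
  U_mul : ∀ x a, U x * π a = π (S.α x a) * U x

namespace CStarDynamicalSystem

variable {Γ : Type v} [AddCommGroup Γ] [LinearOrder Γ] [IsOrderedAddMonoid Γ]
  {A : Type u} [CStarAlgebra A] {S : CStarDynamicalSystem Γ A}

/-- The compression $l_x=U_x^*\,\cdot\,U_x$ satisfies the transfer and completeness identities, and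
these alone give $l_x(a)=L_x(a)l_x(1)$ and $L_x(a)=l_x(a)L_x(1)$. Taking adjoints at $a=1$ yields
$l_x(1)=L_x(1)$, and $L_x(a)L_x(1)=L_x(a)$ finishes. Neither continuity nor positivity of $l_x$ is
needed. -/
theorem FinelyRepresentable.exists_covariantRepresentation (hS : S.FinelyRepresentable)
    (T : S.CompleteTransferAction) :
    ∃ (H : Type (max u v)) (_ : NormedAddCommGroup H) (_ : InnerProductSpace ℂ H)
      (_ : CompleteSpace H), Nonempty (CovariantRepresentation T H) := by
  obtain ⟨H, _, _, _, π, U, hinj, hU, hα, hl, hcomm⟩ := hS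
  choose l hl using hl
  refine ⟨H, inferInstance, inferInstance, inferInstance, ⟨⟨π, U, hinj, hU, hα, ?_, hcomm⟩⟩⟩
  intro x a
  rw [← hl]
  have hUU : U x * star (U x) = π (S.α x 1) := by rw [hα, map_one, mul_one]
  have hcomm' : ∀ a, π a * star (U x) = star (U x) * π (S.α x a) := fun a => by
    have := congrArg star (hcomm x (star a))
    simpa only [star_mul, ← StarHomClass.map_star, star_star] using this
  have htransfer : ∀ a b, l x (S.α x a * b) = a * l x b := fun a b => hinj <| by
    rw [hl, map_mul, map_mul, hl, ← mul_assoc, ← hcomm']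
    simp only [mul_assoc]
  have hstar : star (l x 1) = l x 1 := hinj <| by
    rw [StarHomClass.map_star, hl, star_mul, star_mul, star_star, ← StarHomClass.map_star,
      star_one, mul_assoc]
  have hcomplete : ∀ a, S.α x (l x a) = S.α x 1 * a * S.α x 1 := fun a => hinj <| by
    rw [hα, hl, map_mul, map_mul, ← hUU]
    simp only [mul_assoc]
  have hlright : ∀ a, l x (a * S.α x 1) = l x a := fun a => hinj <| by
    rw [hl, hl, map_mul, mul_assoc, mul_assoc, ← hcomm, map_one, mul_one, mul_assoc]
  have hleft : ∀ a, l x (S.α x 1 * a) = l x a := fun a => by rw [htransfer, one_mul]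
  have h₁ : ∀ a, l x a = T.L x a * l x 1 := fun a => by
    rw [← htransfer, T.complete, mul_one, hlright, hleft]
  have h₂ : ∀ a, T.L x a = l x a * T.L x 1 := fun a => by
    rw [← T.transfer, hcomplete, mul_one, T.L_one_mul_right, T.L_one_mul_left]
  have h₃ : l x 1 = T.L x 1 := by
    have h := congrArg star (h₁ 1)
    rw [star_mul, hstar, ← T.L_star, star_one] at h
    rw [h, ← h₂]
  rw [h₁ a, h₃, ← CompleteTransferAction.transfer_right, T.complete, mul_one,
    α_one_mul_self, T.L_one_mul_right]

theorem absPos_neg (g : Γ) : absPos (-g) = absPos g := Subtype.ext (abs_neg g)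

theorem absPos_zero : absPos (0 : Γ) = 0 := Subtype.ext abs_zero

theorem absPos_coe (x : {x : Γ // 0 ≤ x}) : absPos (x : Γ) = x := Subtype.ext (abs_of_nonneg x.2)

/-! ### Operators on $H$ representing single terms $b\delta_g$. -/

namespace CovariantRepresentation

open CompleteTransferAction

variable {T : S.CompleteTransferAction} {H : Type w}
  [NormedAddCommGroup H] [InnerProductSpace ℂ H] [CompleteSpace H]
  (R : CovariantRepresentation T H)

theorem U_mul_star (x : {x : Γ // 0 ≤ x}) : R.U x * star (R.U x) = R.π (S.α x 1) := by
  rw [R.map_α, map_one, mul_one]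

theorem π_mul_star (x : {x : Γ // 0 ≤ x}) (a : A) :
    R.π a * star (R.U x) = star (R.U x) * R.π (S.α x a) := by
  have := congrArg star (R.U_mul x (star a))
  simpa only [star_mul, ← StarHomClass.map_star, star_star] using this

/-- $U_0$ is an idempotent with $U_0U_0^*=\pi(\alpha_0(1))=1$; multiply $U_0=U_0U_0$ on the right by
$U_0^*$. -/
theorem U_zero : R.U 0 = 1 := by
  have h : R.U 0 * star (R.U 0) = 1 := by rw [U_mul_star, S.map_zero, map_one]
  calc R.U 0 = R.U (0 + 0) * star (R.U 0) := by rw [R.U_add, mul_assoc, h, mul_one]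
    _ = 1 := by rw [add_zero, h]

theorem norm_π (a : A) : ‖R.π a‖ = ‖a‖ := NonUnitalStarAlgHom.norm_map R.π R.injective a

theorem norm_U_le (x : {x : Γ // 0 ≤ x}) : ‖R.U x‖ ≤ 1 := by
  have : ‖R.U x‖ * ‖R.U x‖ ≤ 1 := by
    rw [← CStarRing.norm_self_mul_star, U_mul_star, norm_π]
    exact norm_le_one_of_proj (S.star_α_one x) (S.α_one_mul_self x)
  nlinarith [norm_nonneg (R.U x)]

/-- The operator on `H` representing `b δ_g`. -/
def fiberFun (g : Γ) (b : A) : H →L[ℂ] H :=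
  if 0 ≤ g then R.π b * R.U (absPos g) else star (R.U (absPos g)) * R.π b

theorem fiberFun_of_nonneg {g : Γ} (hg : 0 ≤ g) (b : A) :
    R.fiberFun g b = R.π b * R.U (absPos g) := if_pos hg

/-- Both formulas agree at $g=0$ because $U_0=1$, so later case splits may overlap there. -/
theorem fiberFun_of_nonpos {g : Γ} (hg : g ≤ 0) (b : A) :
    R.fiberFun g b = star (R.U (absPos g)) * R.π b := by
  rcases hg.eq_or_lt with rfl | hg
  · rw [fiberFun_of_nonneg _ le_rfl, absPos_zero, U_zero, star_one, one_mul, mul_one]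
  · exact if_neg hg.not_ge

theorem norm_fiberFun_le (g : Γ) (b : A) : ‖R.fiberFun g b‖ ≤ ‖b‖ := by
  have hU := R.norm_U_le (absPos g)
  rcases le_total 0 g with hg | hg
  · rw [fiberFun_of_nonneg _ hg, ← R.norm_π]
    exact (norm_mul_le _ _).trans (mul_le_of_le_one_right (norm_nonneg _) hU)
  · rw [fiberFun_of_nonpos _ hg, ← R.norm_π]
    exact (norm_mul_le _ _).trans (mul_le_of_le_one_left (norm_nonneg _) (by rwa [norm_star]))

theorem star_fiberFun (g : Γ) (b : A) : star (R.fiberFun g b) = R.fiberFun (-g) (star b) := by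
  rcases le_total 0 g with hg | hg
  · rw [fiberFun_of_nonneg _ hg, fiberFun_of_nonpos _ (neg_nonpos.mpr hg), absPos_neg, star_mul,
      StarHomClass.map_star]
  · rw [fiberFun_of_nonpos _ hg, fiberFun_of_nonneg _ (neg_nonneg.mpr hg), absPos_neg, star_mul,
      star_star, StarHomClass.map_star]

/-- In every case the largest of $|g|,|h|,|g+h|$ is the sum of the other two, so its $U$ factors.
Then either $U^*\pi(ab)U=\pi(L(ab))$ applies, or $U$ is moved past $\pi$ by covariance. Membership
in the coefficient spaces matters only when a product $UU^*=\pi(\alpha(1))$ is left in the middle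
and has to be absorbed, that is for $g+h\ge0>h$ and for $g+h<0<g$. -/
theorem fiberFun_mul {g h : Γ} {a b : A} (ha : a ∈ S.coeffSpace g) (hb : b ∈ S.coeffSpace h) :
    R.fiberFun g a * R.fiberFun h b = R.fiberFun (g + h) (T.mulCoeff g h a b) := by
  unfold CompleteTransferAction.mulCoeff
  split_ifs with h1 h2 h3 h4 h5
  · have hg : 0 ≤ g := by by_contra! hg; exact absurd (add_neg hg h2) h1.not_gt
    have e : absPos g = absPos (g + h) + absPos h := Subtype.ext (by
      simp [absPos, abs_of_nonneg h1, abs_of_neg h2, abs_of_nonneg hg])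
    rw [mem_coeffSpace_of_nonpos S h2.le] at hb
    rw [fiberFun_of_nonneg _ hg, fiberFun_of_nonpos _ h2.le, fiberFun_of_nonneg _ h1, e, R.U_add,
      map_mul, mul_assoc (R.π a), mul_assoc (R.π a), ← R.U_mul]
    -- The second $b$ is the one on the right-hand side; writing it as $\alpha_{|h|}(1)b$ produces
    -- the factor $U_{|h|}U_{|h|}^*$ present on the left.
    nth_rw 2 [← hb]
    rw [map_mul, ← U_mul_star]
    simp only [mul_assoc]
  · have e : absPos h = absPos g + absPos (g + h) := Subtype.ext (by
      simp [absPos, abs_of_nonneg h1, abs_of_neg h3, abs_of_nonneg (not_lt.mp h2)])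
    rw [fiberFun_of_nonpos _ h3.le, fiberFun_of_nonneg _ (not_lt.mp h2), fiberFun_of_nonneg _ h1,
      e, R.U_add, R.map_L, map_mul]
    simp only [mul_assoc]
  · have e : absPos (g + h) = absPos g + absPos h := Subtype.ext (by
      simp [absPos, abs_of_nonneg h1, abs_of_nonneg (not_lt.mp h3),
        abs_of_nonneg (not_lt.mp h2)])
    rw [fiberFun_of_nonneg _ (not_lt.mp h3), fiberFun_of_nonneg _ (not_lt.mp h2),
      fiberFun_of_nonneg _ h1, e, R.U_add, map_mul, mul_assoc (R.π a), ← mul_assoc (R.U _),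
      R.U_mul]
    simp only [mul_assoc]
  · have h1' := (not_le.mp h1)
    have hh : h ≤ 0 := by by_contra! hh; exact h1 (add_pos h4 hh).le
    have e : absPos h = absPos (g + h) + absPos g := Subtype.ext (by
      simp [absPos, abs_of_neg h1', abs_of_nonpos hh, abs_of_pos h4])
    rw [mem_coeffSpace_of_nonneg S h4.le] at ha
    rw [fiberFun_of_nonneg _ h4.le, fiberFun_of_nonpos _ hh, fiberFun_of_nonpos _ h1'.le, e,
      R.U_add, map_mul, ← mul_assoc (star (R.U _)), ← π_mul_star, star_mul]
    -- Likewise $a=a\,\alpha_g(1)$ on the right-hand side supplies $U_gU_g^*$.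
    nth_rw 2 [← ha]
    rw [map_mul, ← U_mul_star]
    simp only [mul_assoc]
  · have h1' := (not_le.mp h1)
    have e : absPos g = absPos h + absPos (g + h) := Subtype.ext (by
      simp [absPos, abs_of_neg h1', abs_of_nonpos (not_lt.mp h4), abs_of_pos h5])
    rw [fiberFun_of_nonpos _ (not_lt.mp h4), fiberFun_of_nonneg _ h5.le,
      fiberFun_of_nonpos _ h1'.le, e, R.U_add, R.map_L, map_mul, star_mul]
    simp only [mul_assoc]
  · have h1' := (not_le.mp h1)
    have e : absPos (g + h) = absPos h + absPos g := Subtype.ext (by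
      simp [absPos, abs_of_neg h1', abs_of_nonpos (not_lt.mp h4), abs_of_nonpos (not_lt.mp h5)])
    rw [fiberFun_of_nonpos _ (not_lt.mp h4), fiberFun_of_nonpos _ (not_lt.mp h5),
      fiberFun_of_nonpos _ h1'.le, e, R.U_add, map_mul, star_mul, mul_assoc, mul_assoc,
      ← mul_assoc (R.π a), π_mul_star]
    simp only [mul_assoc]

/-- By the C*-identity: for $X=\pi(b)U_g$ one has $XX^*=\pi(b\,\alpha_g(1)\,b^*)=\pi(bb^*)$,
precisely because $b\,\alpha_g(1)=b$. For $g\le0$ use $X^*X$ instead. -/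
theorem norm_fiberFun {g : Γ} {b : A} (hb : b ∈ S.coeffSpace g) : ‖R.fiberFun g b‖ = ‖b‖ := by
  refine (mul_self_inj (norm_nonneg _) (norm_nonneg _)).mp ?_
  rw [← R.norm_π b]
  rcases le_total 0 g with hg | hg
  · rw [mem_coeffSpace_of_nonneg S hg] at hb
    rw [← CStarRing.norm_self_mul_star, ← CStarRing.norm_self_mul_star, fiberFun_of_nonneg _ hg,
      star_mul, mul_assoc, ← mul_assoc (R.U _), U_mul_star, ← mul_assoc, ← map_mul, hb]
  · rw [mem_coeffSpace_of_nonpos S hg] at hb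
    rw [← CStarRing.norm_star_mul_self, ← CStarRing.norm_star_mul_self, fiberFun_of_nonpos _ hg,
      star_mul, star_star, mul_assoc, ← mul_assoc (R.U _), U_mul_star, ← map_mul, hb]

/-- `fiberFun g` as a continuous linear map. -/
def fiber (g : Γ) : A →L[ℂ] (H →L[ℂ] H) :=
  LinearMap.mkContinuous
    { toFun := R.fiberFun g
      map_add' := fun a b => by
        unfold fiberFun; split_ifs <;> simp only [_root_.map_add, add_mul, mul_add]
      map_smul' := fun c a => by
        unfold fiberFun
        split_ifs <;> simp only [map_smul, smul_mul_assoc, mul_smul_comm, RingHom.id_apply] }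
    1 fun b => by simpa using R.norm_fiberFun_le g b

/-! ### The regular representation on $\ell^2(\Gamma,H)$. -/

/-- The operator on `ℓ²(Γ, H)` representing `b δ_g`. -/
def regularFiber (g : Γ) :
    A →L[ℂ] (lp (fun _ : Γ => H) 2 →L[ℂ] lp (fun _ : Γ => H) 2) :=
  (lpShiftL H g).comp (R.fiber g)

theorem regularFiber_apply (g : Γ) (b : A) :
    R.regularFiber g b = lpShift g (R.fiberFun g b) := rfl

theorem norm_regularFiber_le (g : Γ) (b : A) : ‖R.regularFiber g b‖ ≤ ‖b‖ :=
  (norm_lpShift_le _ _).trans (R.norm_fiberFun_le g b)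

theorem regularFiber_mul {g h : Γ} {a b : A} (ha : a ∈ S.coeffSpace g)
    (hb : b ∈ S.coeffSpace h) : R.regularFiber g a * R.regularFiber h b =
      R.regularFiber (g + h) (T.mulCoeff g h a b) := by
  rw [regularFiber_apply, regularFiber_apply, regularFiber_apply, lpShift_mul,
    R.fiberFun_mul ha hb]

theorem star_regularFiber (g : Γ) (b : A) :
    star (R.regularFiber g b) = R.regularFiber (-g) (star b) := by
  rw [regularFiber_apply, regularFiber_apply, star_lpShift, star_fiberFun]

theorem summable_norm_regularFiber (a : T.EllOne) :
    Summable fun g => ‖R.regularFiber g (a.coeff g)‖ :=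
  a.summable_norm.of_nonneg_of_le (fun _ => norm_nonneg _) fun _ => R.norm_regularFiber_le _ _

theorem summable_regularFiber (a : T.EllOne) :
    Summable fun g => R.regularFiber g (a.coeff g) :=
  (R.summable_norm_regularFiber a).of_norm

/-- The regular representation of `l₁(Γ, α, A)` on `ℓ²(Γ, H)`. -/
def regularHom :
    T.EllOne →⋆ₙₐ[ℂ] (lp (fun _ : Γ => H) 2 →L[ℂ] lp (fun _ : Γ => H) 2) where
  toFun a := ∑' g, R.regularFiber g (a.coeff g)
  map_smul' c a := by
    simp only [EllOne.coeff_smul, map_smul, MonoidHom.id_apply]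
    exact (R.summable_regularFiber a).tsum_const_smul c
  map_zero' := by simp only [EllOne.coeff_zero, _root_.map_zero, tsum_zero]
  map_add' a b := by
    simp only [EllOne.coeff_add, _root_.map_add]
    exact (R.summable_regularFiber a).tsum_add (R.summable_regularFiber b)
  map_star' a := by
    rw [← (Equiv.neg Γ).tsum_eq, tsum_star]
    exact tsum_congr fun g => by
      rw [star_regularFiber, Equiv.neg_apply, EllOne.coeff_star, neg_neg]
  map_mul' a b := by
    -- The bijection $(k,g)\mapsto(g,k-g)$ sorts the absolutely convergent double series by total
    -- degree $k$, which turns it into the convolution product.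
    let e : Γ × Γ ≃ Γ × Γ :=
      { toFun := fun p => (p.2, p.1 - p.2)
        invFun := fun q => (q.2 + q.1, q.1)
        left_inv := fun p => by simp
        right_inv := fun q => by simp }
    have he : ∀ p : Γ × Γ, R.regularFiber (e p).1 (a.coeff (e p).1) *
        R.regularFiber (e p).2 (b.coeff (e p).2) =
        R.regularFiber p.1 (T.mulCoeff p.2 (p.1 - p.2) (a.coeff p.2) (b.coeff (p.1 - p.2))) :=
      fun p => by
        rw [R.regularFiber_mul (a.coeff_mem _) (b.coeff_mem _)]
        simp only [e, Equiv.coe_fn_mk, add_sub_cancel]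
    have hs := e.summable_iff.mpr (summable_mul_of_summable_norm
      (R.summable_norm_regularFiber a) (R.summable_norm_regularFiber b))
    rw [tsum_mul_tsum_of_summable_norm (R.summable_norm_regularFiber a)
      (R.summable_norm_regularFiber b), ← e.tsum_eq]
    simp only [Function.comp_def, he] at hs ⊢
    rw [hs.tsum_prod]
    exact tsum_congr fun g => by
      rw [EllOne.coeff_mul, (R.regularFiber g).map_tsum (EllOne.summable_mulCoeff a b g)]

theorem regularHom_apply (a : T.EllOne) :
    R.regularHom a = ∑' g, R.regularFiber g (a.coeff g) := rfl

theorem norm_regularHom_le (a : T.EllOne) : ‖R.regularHom a‖ ≤ ‖a‖ := by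
  rw [EllOne.norm_eq, regularHom_apply]
  exact (norm_tsum_le_tsum_norm (R.summable_norm_regularFiber a)).trans
    ((R.summable_norm_regularFiber a).tsum_le_tsum (fun _ => R.norm_regularFiber_le _ _)
      a.summable_norm)

open Classical in
-- The term of degree $k$ moves a vector supported at $0$ to one supported at $k$, so the component
-- at $g$ sees only the term $k=g$.
theorem regularHom_single_apply (a : T.EllOne) (ξ : H) (g : Γ) :
    R.regularHom a (lp.single 2 0 ξ) g = R.fiberFun g (a.coeff g) ξ := by
  have h := (R.summable_regularFiber a).hasSum
  rw [← regularHom_apply] at h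
  have h' := ((h.mapL (ContinuousLinearMap.apply ℂ _ (lp.single 2 (0 : Γ) ξ))).mapL
    (lp.evalCLM ℂ (fun _ : Γ => H) 2 g))
  refine h'.unique ?_
  convert hasSum_single g ?_ using 1
  · change _ = R.fiberFun g (a.coeff g) (lp.single (E := fun _ : Γ => H) 2 0 ξ (g - g))
    rw [sub_self, lp.single_apply_self]
  · intro k hk
    change R.fiberFun k (a.coeff k) (lp.single (E := fun _ : Γ => H) 2 0 ξ (g - k)) = 0
    rw [lp.single_apply_ne _ _ _ (sub_ne_zero.mpr hk.symm), _root_.map_zero]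

theorem norm_coeff_le_norm_regularHom (a : T.EllOne) (g : Γ) :
    ‖a.coeff g‖ ≤ ‖R.regularHom a‖ := by
  classical
  rw [← R.norm_fiberFun (a.coeff_mem g)]
  refine ContinuousLinearMap.opNorm_le_bound _ (norm_nonneg _) fun ξ => ?_
  rw [← regularHom_single_apply]
  refine (lp.norm_apply_le_norm (by simp) _ _).trans
    ((ContinuousLinearMap.le_opNorm _ _).trans_eq ?_)
  rw [lp.norm_single (by simp)]

end CovariantRepresentation

end CStarDynamicalSystem

/-! ### Norm bounds and density for the enveloping algebra. -/

section Enveloping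

variable {B : Type w} [NonUnitalNonAssocRing B] [Module ℂ B] [Star B] [Norm B]

theorem StarRepresentation.norm_hom_le_norm_toEnveloping (R : StarRepresentation B) (b : B) :
    ‖R.hom b‖ ≤ ‖toEnveloping B b‖ :=
  lp.norm_apply_le_norm (E := fun R : StarRepresentation B => R.space →L[ℂ] R.space)
    ENNReal.top_ne_zero (universalHom B b) R

theorem norm_toEnveloping_le (h : ∀ b : B, 0 ≤ ‖b‖) (b : B) : ‖toEnveloping B b‖ ≤ ‖b‖ :=
  lp.norm_le_of_forall_le (E := fun R : StarRepresentation B => R.space →L[ℂ] R.space)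
    (f := universalHom B b) (h b) fun R => R.norm_le b

theorem denseRange_toEnveloping : DenseRange (toEnveloping B) := by
  rintro ⟨z, hz⟩
  refine (closure_subtype (p := fun z => z ∈
    (NonUnitalStarAlgHom.range (universalHom B)).topologicalClosure)).mpr
    (closure_mono ?_ (show z ∈ closure (NonUnitalStarAlgHom.range (universalHom B) :
      Set (RepresentationProduct B)) from hz))
  rintro _ ⟨b, rfl⟩
  exact ⟨toEnveloping B b, ⟨b, rfl⟩, rfl⟩

end Enveloping

/-! ### The enveloping norm dominates the coefficients. -/

namespace CStarDynamicalSystem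

variable {Γ : Type v} [AddCommGroup Γ] [LinearOrder Γ] [IsOrderedAddMonoid Γ]
  {A : Type u} [CStarAlgebra A] {S : CStarDynamicalSystem Γ A}

/-- The representation of `l₁(Γ, α, A)` on `ℓ²(Γ, H)` as a `StarRepresentation`. -/
def CovariantRepresentation.regular {T : S.CompleteTransferAction} {H : Type (max u v)}
    [NormedAddCommGroup H] [InnerProductSpace ℂ H] [CompleteSpace H]
    (R : CovariantRepresentation T H) : StarRepresentation T.EllOne where
  space := lp (fun _ : Γ => H) 2
  hom := R.regularHom
  norm_le := R.norm_regularHom_le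

theorem α_one_mul_α (S : CStarDynamicalSystem Γ A) (x : {x : Γ // 0 ≤ x}) (a : A) :
    S.α x 1 * S.α x a = S.α x a := by rw [← map_mul, one_mul]

theorem α_mul_α_one (S : CStarDynamicalSystem Γ A) (x : {x : Γ // 0 ≤ x}) (a : A) :
    S.α x a * S.α x 1 = S.α x a := by rw [← map_mul, mul_one]

theorem mul_α_one_mem_coeffSpace (S : CStarDynamicalSystem Γ A) (x : {x : Γ // 0 ≤ x}) (a : A) :
    a * S.α x 1 ∈ S.coeffSpace (x : Γ) := by
  rw [mem_coeffSpace_of_nonneg S x.2, absPos_coe, mul_assoc, α_one_mul_self]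

theorem α_one_mul_mem_coeffSpace (S : CStarDynamicalSystem Γ A) (x : {x : Γ // 0 ≤ x}) (a : A) :
    S.α x 1 * a ∈ S.coeffSpace (-(x : Γ)) := by
  rw [mem_coeffSpace_of_nonpos S (neg_nonpos.mpr x.2), absPos_neg, absPos_coe, ← mul_assoc,
    α_one_mul_self]

namespace CompleteTransferAction

variable {T : S.CompleteTransferAction}

/-- The space $\ell^2(\Gamma,H)$ lies in the universe of $l_1(\Gamma,\alpha,\mathcal A)$, so the
regular representation is among those over which the enveloping norm is the supremum. -/
theorem norm_coeff_le_norm_toEnveloping (hS : S.FinelyRepresentable) (f : T.EllOne) (g : Γ) :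
    ‖f.coeff g‖ ≤ ‖toEnveloping T.EllOne f‖ := by
  obtain ⟨H, _, _, _, ⟨R⟩⟩ := hS.exists_covariantRepresentation T
  exact (R.norm_coeff_le_norm_regularHom f g).trans
    (R.regular.norm_hom_le_norm_toEnveloping f)

theorem toEnveloping_injective (hS : S.FinelyRepresentable) :
    Function.Injective (toEnveloping T.EllOne) := by
  rw [injective_iff_map_eq_zero]
  intro f hf
  refine EllOne.ext fun g => norm_le_zero_iff.mp ?_
  simpa [hf] using norm_coeff_le_norm_toEnveloping hS f g

theorem L_zero (T : S.CompleteTransferAction) (a : A) : T.L 0 a = a := by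
  simpa only [S.map_zero, one_mul, mul_one] using T.complete 0 a

/-! ### Calculus of one-term families $a\delta_g$. -/

namespace EllOne

open Classical in
theorem coeff_delta (g : Γ) (a : A) (ha : a ∈ S.coeffSpace g) (k : Γ) :
    (delta T g a ha).coeff k = if k = g then a else 0 := rfl

/-- Serves to change degree and coefficient together, since the membership proof depends on both. -/
theorem delta_congr {g h : Γ} {a b : A} (hgh : g = h) (hab : a = b) (ha : a ∈ S.coeffSpace g)
    (hb : b ∈ S.coeffSpace h) : delta T g a ha = delta T h b hb := by
  subst hgh hab; rfl

theorem delta_mul_delta {g h : Γ} {a b : A} (ha : a ∈ S.coeffSpace g) (hb : b ∈ S.coeffSpace h) :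
    delta T g a ha * delta T h b hb =
      delta T (g + h) (T.mulCoeff g h a b) (T.mulCoeff_mem ha hb) := by
  refine ext fun k => ?_
  rw [coeff_mul, tsum_eq_single g]
  · simp only [coeff_delta, if_true, sub_eq_iff_eq_add']
    split_ifs with hk
    · rw [hk, add_sub_cancel_left]
    · exact T.mulCoeff_zero_right _ _ _
  · intro l hl
    rw [coeff_delta, if_neg hl, mulCoeff_zero_left]

theorem star_delta {g : Γ} {a : A} (ha : a ∈ S.coeffSpace g) (ha' : star a ∈ S.coeffSpace (-g)) :
    star (delta T g a ha) = delta T (-g) (star a) ha' := by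
  refine ext fun k => ?_
  simp only [coeff_star, coeff_delta, neg_eq_iff_eq_neg]
  split_ifs <;> simp

theorem delta_mul_delta_eq {g h k : Γ} {a b c : A} (ha : a ∈ S.coeffSpace g)
    (hb : b ∈ S.coeffSpace h) (hc : c ∈ S.coeffSpace k) (hk : g + h = k)
    (habc : T.mulCoeff g h a b = c) : delta T g a ha * delta T h b hb = delta T k c hc := by
  rw [delta_mul_delta]
  exact delta_congr hk habc _ _

end EllOne

theorem mulCoeff_of_nonneg (T : S.CompleteTransferAction) (x y : {x : Γ // 0 ≤ x}) (a b : A) :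
    T.mulCoeff x y a b = a * S.α x b := by
  rw [mulCoeff, if_pos (add_nonneg x.2 y.2), if_neg y.2.not_gt, if_neg x.2.not_gt, absPos_coe]

theorem mulCoeff_self_neg (T : S.CompleteTransferAction) (x : {x : Γ // 0 ≤ x}) (a b : A) :
    T.mulCoeff x (-(x : Γ)) a b = a * b := by
  simp only [mulCoeff, add_neg_cancel, le_refl, if_true, absPos_zero, S.map_zero]
  split_ifs with h₁ h₂
  · rfl
  · exact absurd h₂ x.2.not_gt
  · obtain rfl : x = 0 := Subtype.ext (le_antisymm (by simpa using h₁) x.2)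
    change a * S.α (absPos (0 : Γ)) b = a * b
    rw [absPos_zero, S.map_zero]

/-- At $x=0$ the product falls into the branch $a\,\alpha_0(b)$ instead of the transfer branch; the
two agree because $\alpha_0$ and $L_0$ are the identity. -/
theorem mulCoeff_neg_self (T : S.CompleteTransferAction) (x : {x : Γ // 0 ≤ x}) (a b : A) :
    T.mulCoeff (-(x : Γ)) x a b = T.L x (a * b) := by
  rcases x.2.eq_or_lt with hx | hx
  · obtain rfl : x = 0 := Subtype.ext hx.symm
    simp [mulCoeff, absPos_zero, S.map_zero, L_zero]
  · rw [mulCoeff, neg_add_cancel, if_pos le_rfl, if_neg x.2.not_gt, if_pos (neg_neg_of_pos hx),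
      absPos_neg, absPos_coe]

theorem mulCoeff_neg_zero (T : S.CompleteTransferAction) (x : {x : Γ // 0 ≤ x}) (a b : A) :
    T.mulCoeff (-(x : Γ)) 0 a b = a * b := by
  rcases x.2.eq_or_lt with hx | hx
  · obtain rfl : x = 0 := Subtype.ext hx.symm
    simp [mulCoeff, absPos_zero, S.map_zero]
  · rw [mulCoeff, if_neg (by simpa using hx), if_neg (by simpa using hx.le), if_neg (lt_irrefl _),
      absPos_zero, S.map_zero]

theorem mulCoeff_zero_coe (T : S.CompleteTransferAction) (x : {x : Γ // 0 ≤ x}) (a b : A) :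
    T.mulCoeff 0 x a b = a * b := by
  rw [mulCoeff, if_pos (by simpa using x.2), if_neg x.2.not_gt, if_neg (lt_irrefl _), absPos_zero,
    S.map_zero]

/-! ### The relations between $u_x$ and $\mathcal A$. -/

theorem u_coe (T : S.CompleteTransferAction) (x : {x : Γ // 0 ≤ x}) :
    T.u (x : Γ) = toEnveloping T.EllOne
      (EllOne.delta T x (S.α x 1) (by simpa using S.mul_α_one_mem_coeffSpace x 1)) :=
  congrArg _ (EllOne.delta_congr rfl (by rw [absPos_coe]) _ _)

theorem u_neg_coe (T : S.CompleteTransferAction) (x : {x : Γ // 0 ≤ x}) :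
    T.u (-(x : Γ)) = toEnveloping T.EllOne
      (EllOne.delta T (-(x : Γ)) (S.α x 1) (by simpa using S.α_one_mul_mem_coeffSpace x 1)) :=
  congrArg _ (EllOne.delta_congr rfl (by rw [absPos_neg, absPos_coe]) _ _)

theorem star_u (T : S.CompleteTransferAction) (x : {x : Γ // 0 ≤ x}) :
    star (T.u (x : Γ)) = T.u (-(x : Γ)) := by
  rw [u_coe, u_neg_coe, ← map_star, EllOne.star_delta]
  · exact congrArg _ (EllOne.delta_congr rfl (S.star_α_one x) _ _)
  · rw [S.star_α_one]; simpa using S.α_one_mul_mem_coeffSpace x 1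

theorem u_add (T : S.CompleteTransferAction) (x y : {x : Γ // 0 ≤ x}) :
    T.u (x + y : Γ) = T.u (x : Γ) * T.u (y : Γ) := by
  change T.u ((x + y : {x : Γ // 0 ≤ x}) : Γ) = _
  rw [u_coe, u_coe, u_coe, ← map_mul]
  refine congrArg _ (EllOne.delta_mul_delta_eq _ _ _ rfl ?_).symm
  rw [mulCoeff_of_nonneg, α_one_mul_α, S.map_add]

/-- No condition on $a$ is needed, because $u_x$ itself carries the projection $\alpha_x(1)$. For
$a\in\mathcal A\alpha_x(1)$ the Fourier term $a u_x$ is therefore the image of $a\delta_x$. -/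
theorem ofCoeff_mul_u (T : S.CompleteTransferAction) (x : {x : Γ // 0 ≤ x}) (a : A) :
    T.ofCoeff a * T.u (x : Γ) = toEnveloping T.EllOne
      (EllOne.delta T x (a * S.α x 1) (S.mul_α_one_mem_coeffSpace x a)) := by
  rw [u_coe, ofCoeff, ← map_mul]
  exact congrArg _ (EllOne.delta_mul_delta_eq _ _ _ (zero_add _) (T.mulCoeff_zero_coe _ _ _))

theorem star_u_mul_ofCoeff (T : S.CompleteTransferAction) (x : {x : Γ // 0 ≤ x}) (a : A) :
    star (T.u (x : Γ)) * T.ofCoeff a = toEnveloping T.EllOne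
      (EllOne.delta T (-(x : Γ)) (S.α x 1 * a) (S.α_one_mul_mem_coeffSpace x a)) := by
  rw [star_u, u_neg_coe, ofCoeff, ← map_mul]
  exact congrArg _ (EllOne.delta_mul_delta_eq _ _ _ (add_zero _) (T.mulCoeff_neg_zero _ _ _))

theorem u_mul_ofCoeff_mul_star (T : S.CompleteTransferAction) (x : {x : Γ // 0 ≤ x}) (a : A) :
    T.u (x : Γ) * T.ofCoeff a * star (T.u (x : Γ)) = T.ofCoeff (S.α x a) := by
  have h : T.u (x : Γ) * T.ofCoeff a = toEnveloping T.EllOne (EllOne.delta T x (S.α x a)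
      (by simpa only [α_mul_α_one] using S.mul_α_one_mem_coeffSpace x (S.α x a))) := by
    rw [u_coe, ofCoeff, ← map_mul]
    refine congrArg _ (EllOne.delta_mul_delta_eq _ _ _ (add_zero _) ?_)
    exact (T.mulCoeff_of_nonneg x 0 _ _).trans (S.α_one_mul_α x a)
  rw [h, star_u, u_neg_coe, ofCoeff, ← map_mul]
  refine congrArg _ (EllOne.delta_mul_delta_eq _ _ _ (add_neg_cancel _) ?_)
  rw [mulCoeff_self_neg, α_mul_α_one]

theorem star_u_mul_ofCoeff_mul_u (T : S.CompleteTransferAction) (x : {x : Γ // 0 ≤ x}) (a : A) :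
    star (T.u (x : Γ)) * T.ofCoeff a * T.u (x : Γ) = T.ofCoeff (T.L x a) := by
  rw [star_u_mul_ofCoeff, u_coe, ofCoeff, ← map_mul]
  refine congrArg _ (EllOne.delta_mul_delta_eq _ _ _ (neg_add_cancel _) ?_)
  rw [mulCoeff_neg_self, L_one_mul_right, L_one_mul_left]

theorem ofCoeff_mul (T : S.CompleteTransferAction) (a b : A) :
    T.ofCoeff (a * b) = T.ofCoeff a * T.ofCoeff b := by
  rw [ofCoeff, ofCoeff, ofCoeff, ← map_mul]
  exact congrArg _ (EllOne.delta_mul_delta_eq _ _ _ (add_zero _)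
    (T.mulCoeff_zero_coe 0 _ _)).symm

/-- Allows an identity between elements of $\mathcal A$ to be read off inside the crossed product,
as the coefficient conditions of `IsFourierSum` require. -/
theorem ofCoeff_injective (hS : S.FinelyRepresentable) : Function.Injective T.ofCoeff := by
  intro a b h
  simpa [EllOne.coeff_delta] using
    congrArg (EllOne.coeff · 0) (toEnveloping_injective hS h)

/-- Makes the covariance relation at $a=1$ into a formula for $u_xu_x^*$. -/
theorem u_mul_ofCoeff_one (T : S.CompleteTransferAction) (x : {x : Γ // 0 ≤ x}) :
    T.u (x : Γ) * T.ofCoeff 1 = T.u (x : Γ) := by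
  rw [u_coe, ofCoeff, ← map_mul]
  refine congrArg _ (EllOne.delta_mul_delta_eq _ _ _ (add_zero _) ?_)
  exact (T.mulCoeff_of_nonneg x 0 _ _).trans (S.α_one_mul_α x 1)

theorem u_mul_star_u (T : S.CompleteTransferAction) (x : {x : Γ // 0 ≤ x}) :
    T.u (x : Γ) * star (T.u (x : Γ)) = T.ofCoeff (S.α x 1) := by
  rw [← u_mul_ofCoeff_mul_star, u_mul_ofCoeff_one]

theorem u_mul_star_u_mul_u (T : S.CompleteTransferAction) (x : {x : Γ // 0 ≤ x}) :
    T.u (x : Γ) * star (T.u (x : Γ)) * T.u (x : Γ) = T.u (x : Γ) := by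
  rw [u_mul_star_u, ofCoeff_mul_u, u_coe]
  exact congrArg _ (EllOne.delta_congr rfl (S.α_one_mul_self x) _ _)

/-! ### Finitely supported families and their images. -/

namespace EllOne

theorem coeff_sum {ι : Type*} (s : Finset ι) (f : ι → T.EllOne) (g : Γ) :
    (∑ i ∈ s, f i).coeff g = ∑ i ∈ s, (f i).coeff g :=
  map_sum (⟨⟨fun a : T.EllOne => a.coeff g, coeff_zero g⟩, fun a b => coeff_add a b g⟩ :
    T.EllOne →+ A) f s

theorem finite_support_mul {a b : T.EllOne} (ha : (Function.support a.coeff).Finite)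
    (hb : (Function.support b.coeff).Finite) : (Function.support (a * b).coeff).Finite := by
  refine (Set.Finite.image2 (· + ·) ha hb).subset fun g hg => ?_
  by_contra h
  refine hg ?_
  rw [coeff_mul, ← tsum_zero]
  refine tsum_congr fun k => ?_
  by_cases hk : a.coeff k = 0
  · rw [hk, mulCoeff_zero_left]
  · have : b.coeff (g - k) = 0 := by
      by_contra hgk
      exact h ⟨k, hk, g - k, hgk, add_sub_cancel k g⟩
    rw [this, mulCoeff_zero_right]

variable (T) in
/-- The finitely supported elements of `l₁(Γ, α, A)`. -/
def finiteSupport : NonUnitalStarSubalgebra ℂ T.EllOne where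
  carrier := {a | (Function.support a.coeff).Finite}
  add_mem' {a b} ha hb := (ha.union hb).subset (Function.support_add a.coeff b.coeff)
  zero_mem' := by simp [Function.support, coeff_zero]
  smul_mem' c a ha := ha.subset (Function.support_const_smul_subset c a.coeff)
  mul_mem' := finite_support_mul
  star_mem' {a} ha := by
    refine (ha.image (fun g => -g)).subset fun g hg => ⟨-g, fun h => hg ?_, neg_neg g⟩
    rw [coeff_star, h, star_zero]

/-- Truncations to finite sets of degrees converge, the error being the tail of the series
$\sum\|a_g\|$. -/
theorem dense_finiteSupport : Dense (finiteSupport T : Set T.EllOne) := by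
  classical
  intro a
  let f : Finset Γ → T.EllOne := fun s => ∑ g ∈ s, delta T g (a.coeff g) (a.coeff_mem g)
  have hf : ∀ s g, (f s).coeff g = if g ∈ s then a.coeff g else 0 := fun s g => by
    simp only [f, coeff_sum, coeff_delta, Finset.sum_ite_eq]
  have hnorm : ∀ s, ‖a - f s‖ = ∑' g : { g // g ∉ s }, ‖a.coeff g‖ := fun s => by
    rw [norm_eq]
    refine (tsum_congr fun g => ?_).trans
      (tsum_subtype {g | g ∉ s} fun g => ‖a.coeff g‖).symm
    rw [sub_eq_add_neg, ← neg_one_smul ℂ, coeff_add, coeff_smul, hf, Set.indicator_apply]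
    by_cases hg : g ∈ s <;> simp [hg]
  refine mem_closure_of_tendsto (f := f) (b := Filter.atTop) ?_ (Filter.Eventually.of_forall
    fun s => s.finite_toSet.subset fun g hg => ?_)
  · rw [tendsto_iff_norm_sub_tendsto_zero]
    simp only [norm_sub_rev, hnorm]
    exact tendsto_tsum_compl_atTop_zero fun g => ‖a.coeff g‖
  · by_contra hgs
    exact hg ((hf s g).trans (if_neg hgs))

/-- Since $0\notin F$, the degrees $-x$, $0$ and $y$ with $x,y\in F$ never coincide, so in each
degree at most one of all the terms survives. -/
theorem eq_sum_delta {F : Finset {x : Γ // 0 ≤ x}} (hF : 0 ∉ F) (f : T.EllOne)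
    (hf : ∀ g : Γ, g ≠ 0 → (∀ x ∈ F, g ≠ (x : Γ) ∧ g ≠ -(x : Γ)) → f.coeff g = 0) :
    f = ∑ x ∈ F, delta T (-(x : Γ)) (f.coeff (-(x : Γ))) (f.coeff_mem _) +
      delta T 0 (f.coeff 0) (f.coeff_mem _) +
      ∑ x ∈ F, delta T (x : Γ) (f.coeff (x : Γ)) (f.coeff_mem _) := by
  classical
  have hpos : ∀ x ∈ F, 0 < (x : Γ) := fun x hx =>
    x.2.lt_of_ne fun h => hF (by rwa [show (0 : {x : Γ // 0 ≤ x}) = x from Subtype.ext h])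
  refine ext fun k => ?_
  simp only [coeff_add, coeff_sum, coeff_delta]
  by_cases hk : ∀ x ∈ F, k ≠ (x : Γ) ∧ k ≠ -(x : Γ)
  · rw [Finset.sum_eq_zero fun x hx => if_neg (hk x hx).2,
      Finset.sum_eq_zero fun x hx => if_neg (hk x hx).1, zero_add, add_zero]
    split_ifs with h0
    · rw [h0]
    · exact hf k h0 hk
  · push Not at hk
    obtain ⟨x, hx, hk⟩ := hk
    by_cases hkx : k = x
    · subst hkx
      rw [Finset.sum_eq_zero fun y hy => if_neg ((neg_neg_of_pos (hpos y hy)).trans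
        (hpos x hx)).ne', if_neg (hpos x hx).ne', Finset.sum_eq_single_of_mem x hx
        fun y _ hy => if_neg fun h => hy (Subtype.ext h.symm), if_pos rfl, zero_add, zero_add]
    · obtain rfl := hk hkx
      rw [Finset.sum_eq_zero (s := F)
        (f := fun y => if -(x : Γ) = (y : Γ) then f.coeff (y : Γ) else 0)
        fun y hy => if_neg ((neg_neg_of_pos (hpos x hx)).trans (hpos y hy)).ne,
        if_neg (neg_neg_of_pos (hpos x hx)).ne, Finset.sum_eq_single_of_mem x hx fun y _ hy => if_neg fun h => hy (Subtype.ext (neg_injective h.symm)), if_pos rfl,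
        add_zero, add_zero]

theorem toEnveloping_eq_sum {F : Finset {x : Γ // 0 ≤ x}} (hF : 0 ∉ F) (f : T.EllOne)
    (hf : ∀ g : Γ, g ≠ 0 → (∀ x ∈ F, g ≠ (x : Γ) ∧ g ≠ -(x : Γ)) → f.coeff g = 0) :
    toEnveloping T.EllOne f =
      ∑ x ∈ F, star (T.u (x : Γ)) * T.ofCoeff (f.coeff (-(x : Γ))) + T.ofCoeff (f.coeff 0) +
        ∑ x ∈ F, T.ofCoeff (f.coeff (x : Γ)) * T.u (x : Γ) := by
  conv_lhs => rw [eq_sum_delta hF f hf]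
  rw [_root_.map_add, _root_.map_add, map_sum, map_sum]
  refine congrArg₂ (· + ·) (congrArg₂ (· + ·) (Finset.sum_congr rfl fun x _ => ?_) rfl)
    (Finset.sum_congr rfl fun x _ => ?_)
  · rw [star_u_mul_ofCoeff]
    refine congrArg _ (delta_congr rfl ?_ _ _)
    have h := (mem_coeffSpace_of_nonpos S (neg_nonpos.mpr x.2)).mp (f.coeff_mem (-(x : Γ)))
    rw [absPos_neg, absPos_coe] at h
    exact h.symm
  · rw [ofCoeff_mul_u]
    refine congrArg _ (delta_congr rfl ?_ _ _)
    have h := (mem_coeffSpace_of_nonneg S x.2).mp (f.coeff_mem (x : Γ))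
    rw [absPos_coe] at h
    exact h.symm

end EllOne

/-! ### Fourier sums are the images of finitely supported families. -/

/-- Because $u_xu_x^*=\alpha_x(1)$ and $\mathcal A$ embeds, the conditions on $c_{\pm x}$ in the
crossed product say that $c_{\pm x}$ lies in its coefficient space. Hence $c$ itself is an element
of $l_1$, and all statements about Fourier sums reduce to statements about `toEnveloping`. -/
theorem IsFourierSum.exists_ellOne (hS : S.FinelyRepresentable) {F : Finset {x : Γ // 0 ≤ x}}
    {c : Γ → A} {a : T.CrossedProduct} (h : T.IsFourierSum F c a) :
    ∃ f ∈ EllOne.finiteSupport T, f.coeff = c ∧ toEnveloping T.EllOne f = a := by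
  classical
  have hfin : (Function.support c).Finite := by
    refine (insert 0 (F.image Subtype.val ∪
      F.image fun x : {x : Γ // 0 ≤ x} => -(x : Γ))).finite_toSet.subset fun g hg => ?_
    by_contra hgF
    simp only [SetLike.mem_coe, Finset.mem_insert, Finset.mem_union, Finset.mem_image, not_or,
      not_exists, not_and] at hgF
    exact hg (h.coeff_eq_zero g hgF.1 fun x hx =>
      ⟨fun e => hgF.2.1 x hx e.symm, fun e => hgF.2.2 x hx e.symm⟩)
  have hmem : ∀ g, c g ∈ S.coeffSpace g := by
    intro g
    by_cases h0 : g = 0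
    · rw [h0]
      exact S.mem_coeffSpace_zero _
    by_cases hg : ∀ x ∈ F, g ≠ (x : Γ) ∧ g ≠ -(x : Γ)
    · rw [h.coeff_eq_zero g h0 hg]
      exact Submodule.zero_mem _
    push Not at hg
    obtain ⟨x, hx, hg⟩ := hg
    by_cases hgx : g = x
    · obtain ⟨b, hb⟩ := h.coeff_pos x hx
      rw [u_mul_star_u, ← ofCoeff_mul] at hb
      rw [hgx, ofCoeff_injective hS hb]
      exact S.mul_α_one_mem_coeffSpace x b
    · obtain ⟨b, hb⟩ := h.coeff_neg x hx
      rw [u_mul_star_u, ← ofCoeff_mul] at hb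
      rw [hg hgx, ofCoeff_injective hS hb]
      exact S.α_one_mul_mem_coeffSpace x b
  let f : T.EllOne := EllOne.mk c hmem (summable_of_ne_finset_zero (s := hfin.toFinset)
    fun g hg => by simpa using hg)
  exact ⟨f, hfin, rfl,
    (EllOne.toEnveloping_eq_sum h.zero_notMem f h.coeff_eq_zero).trans h.eq_sum.symm⟩

theorem exists_isFourierSum {f : T.EllOne} (hf : f ∈ EllOne.finiteSupport T) :
    ∃ F, T.IsFourierSum F f.coeff (toEnveloping T.EllOne f) := by
  classical
  -- All $|g|\neq0$ with $g$ in the support; if only one of $\pm x$ is in the support, the other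
  -- coefficient is simply $0$.
  let F : Finset {x : Γ // 0 ≤ x} := (hf.toFinset.image absPos).erase 0
  have hF : 0 ∉ F := Finset.notMem_erase _ _
  have hzero : ∀ g : Γ, g ≠ 0 → (∀ x ∈ F, g ≠ (x : Γ) ∧ g ≠ -(x : Γ)) → f.coeff g = 0 := by
    intro g h0 hg
    by_contra hc
    have hx : absPos g ∈ F := Finset.mem_erase.mpr
      ⟨fun e => h0 (abs_eq_zero.mp (congrArg Subtype.val e)),
        Finset.mem_image_of_mem _ (hf.mem_toFinset.mpr hc)⟩
    rcases le_total 0 g with h | h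
    · exact (hg _ hx).1 (abs_of_nonneg h).symm
    · exact (hg _ hx).2 (by change g = -|g|; rw [abs_of_nonpos h, neg_neg])
  -- Each coefficient is its own witness, being fixed by multiplication with the projection
  -- $u_xu_x^*=\alpha_x(1)$.
  refine ⟨F, hF, fun x _ => ⟨f.coeff x, ?_⟩, fun x _ => ⟨f.coeff (-(x : Γ)), ?_⟩, hzero,
    EllOne.toEnveloping_eq_sum hF f hzero⟩
  · have h := (mem_coeffSpace_of_nonneg S x.2).mp (f.coeff_mem (x : Γ))
    rw [absPos_coe] at h
    rw [u_mul_star_u, ← ofCoeff_mul, h]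
  · have h := (mem_coeffSpace_of_nonpos S (neg_nonpos.mpr x.2)).mp (f.coeff_mem (-(x : Γ)))
    rw [absPos_neg, absPos_coe] at h
    rw [u_mul_star_u, ← ofCoeff_mul, h]

/-- Identifying the set of Fourier sums with the image of a $*$-subalgebra gives its closure under
products and adjoints at no further cost. -/
theorem coe_map_finiteSupport (hS : S.FinelyRepresentable) :
    ((EllOne.finiteSupport T).map (toEnveloping T.EllOne) : Set T.CrossedProduct) =
      {a | ∃ F c, T.IsFourierSum F c a} := by
  ext a
  constructor
  · rintro ⟨f, hf, rfl⟩
    obtain ⟨F, hF⟩ := exists_isFourierSum hf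
    exact ⟨F, f.coeff, hF⟩
  · rintro ⟨F, c, h⟩
    obtain ⟨f, hf, -, rfl⟩ := h.exists_ellOne hS
    exact ⟨f, hf, rfl⟩

theorem dense_map_finiteSupport : Dense
    ((EllOne.finiteSupport T).map (toEnveloping T.EllOne) : Set T.CrossedProduct) := by
  have hcont : Continuous (toEnveloping T.EllOne) :=
    AddMonoidHomClass.continuous_of_bound (toEnveloping T.EllOne) 1 fun b => by
      simpa using norm_toEnveloping_le norm_nonneg b
  exact denseRange_toEnveloping.dense_image hcont EllOne.dense_finiteSupport

end CompleteTransferAction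

end CStarDynamicalSystem
end

/-! ### The main theorem. -/

theorem theorem5p4 {Γ : Type*} [AddCommGroup Γ] [LinearOrder Γ] [IsOrderedAddMonoid Γ]
    {A : Type*} [CStarAlgebra A] (S : CStarDynamicalSystem Γ A) (hS : S.FinelyRepresentable)
    (T : S.CompleteTransferAction) (hT : T = hS.transferAction) :
    -- semigroup of partial isometries
    (∀ x y : {x : Γ // 0 ≤ x}, T.u (x + y : Γ) = T.u (x : Γ) * T.u (y : Γ)) ∧
    (∀ x : {x : Γ // 0 ≤ x},
      T.u (x : Γ) * star (T.u (x : Γ)) * T.u (x : Γ) = T.u (x : Γ)) ∧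
    -- the covariance relations
    (∀ x : {x : Γ // 0 ≤ x}, star (T.u (x : Γ)) = T.u (-(x : Γ))) ∧
    (∀ (x : {x : Γ // 0 ≤ x}) (a : A),
      T.u (x : Γ) * T.ofCoeff a * star (T.u (x : Γ)) = T.ofCoeff (S.α x a)) ∧
    (∀ (x : {x : Γ // 0 ≤ x}) (a : A),
      star (T.u (x : Γ)) * T.ofCoeff a * T.u (x : Γ) = T.ofCoeff (T.L x a)) ∧
    -- the finite sums form a dense `*`-subalgebra
    (∃ C₀ : NonUnitalStarSubalgebra ℂ T.CrossedProduct,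
      (C₀ : Set T.CrossedProduct) = {a | ∃ F c, T.IsFourierSum F c a} ∧
      Dense (C₀ : Set T.CrossedProduct)) ∧
    -- the coefficient estimates and the uniqueness of the coefficients
    (∀ F c a, T.IsFourierSum F c a → ∀ g : Γ, ‖c g‖ ≤ ‖a‖) ∧
    (∀ F c F' c' a, T.IsFourierSum F c a → T.IsFourierSum F' c' a → c = c') := by
  refine ⟨T.u_add, T.u_mul_star_u_mul_u, T.star_u, T.u_mul_ofCoeff_mul_star,
    T.star_u_mul_ofCoeff_mul_u, ⟨_,
      CStarDynamicalSystem.CompleteTransferAction.coe_map_finiteSupport hS,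
      CStarDynamicalSystem.CompleteTransferAction.dense_map_finiteSupport⟩, ?_, ?_⟩
  · intro F c a h g
    obtain ⟨f, -, rfl, rfl⟩ := h.exists_ellOne hS
    exact CStarDynamicalSystem.CompleteTransferAction.norm_coeff_le_norm_toEnveloping hS f g
  · intro F c F' c' a h h'
    obtain ⟨f, -, rfl, hf⟩ := h.exists_ellOne hS
    obtain ⟨f', -, rfl, hf'⟩ := h'.exists_ellOne hS
    -- Both coefficient families come from elements of $l_1$ with the same image, so injectivity
    -- identifies them.
    rw [CStarDynamicalSystem.CompleteTransferAction.toEnveloping_injective hS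
      (hf.trans hf'.symm)]
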